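/- Let $G$ be a second-countable, locally compact group, $A$ a separable $\mathrm{C}^*$-algebra and $B$ a $\sigma$-unital $\mathrm{C}^*$-algebra with multiplier algebra $\mathcal M(B)$, and let $\alpha: G\curvearrowright A$ and $\beta: G\curvearrowright B$ be two point-norm continuous actions by $*$-automorphisms; write $\beta$ also for the canonical extension to $\mathcal M(B)$. A cocycle representation $(\varphi,\mathbf u):(A,\alpha)\to(\mathcal M(B),\beta)$ consists of a $*$-homomorphism $\varphi:A\to\mathcal M(B)$ and a strictly continuous map $\mathbf u:G\to\mathcal U(\mathcal M(B))$ such that $\mathbf u_{gh}=\mathbf u_g\beta_g(\mathbf u_h)$ and $\mathbf u_g\beta_g(\varphi(a))\mathbf u_g^*=\varphi(\alpha_g(a))$ for all $g,h\in G$, $a\in A$. For such a pair put \[ D_{(\varphi,\mathbf u)}=\{x\in\mathcal M(B)\mid x-\mathbf u_g\beta_g(x)\mathbf u_g^*\in B \text{ and } x\varphi(a)-\varphi(a)x\in B \text{ for all } g\in G,\ a\in A\}. \] Let $(\varphi,\mathbf u),(\psi,\mathbf v):(A,\alpha)\to(\mathcal M(B),\beta)$ be two cocycle representations. Suppose that there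 exists a norm-continuous path of unitaries $U:[0,\infty)\to\mathcal U(D_{(\varphi,\mathbf u)})$ with $U_0=\mathbf 1$ and \[ \lim_{t\to\infty}\Big(\|\psi(a)-U_t\varphi(a)U_t^*\|+\max_{g\in K}\|\mathbf v_g-U_t\mathbf u_g\beta_g(U_t)^*\|\Big)=0 \] for all $a\in A$ and every compact set $K\subseteq G$. Then $(\varphi,\mathbf u)$ and $(\psi,\mathbf v)$ are strongly asymptotically unitarily equivalent, that is, there exists a norm-continuous path $v:[0,\infty)\to\mathcal U(\mathbf 1+B)$ (the unitaries $x$ with $x-\mathbf 1\in B$) with $v_0=\mathbf 1$ such that \[ \lim_{t\to\infty}\|\psi(a)-v_t\varphi(a)v_t^*\|=0 \quad\text{and}\quad \lim_{t\to\infty}\max_{g\in K}\|\mathbf v_g-v_t\mathbf u_g\beta_g(v_t)^*\|=0 \] for all $a\in A$ and every compact set $K\subseteq G$. -/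

import Mathlib

open Filter Topology
open scoped NNReal MultiplierAlgebra

noncomputable section

/-- A C⋆-algebra is σ-unital if it has a countable approximate unit, i.e. a sequence of positive
contractions `e n` with `e n * b → b` for all `b` (then `b * e n → b` by taking adjoints). -/
def IsSigmaUnital (B : Type*) [NonUnitalCStarAlgebra B] : Prop :=
  ∃ e : ℕ → B, (∀ n, ∃ c : B, e n = star c * c) ∧ (∀ n, ‖e n‖ ≤ 1) ∧
    ∀ b : B, Tendsto (fun n => e n * b) atTop (𝓝 b)

/-- A continuous action of a topological group on a C⋆-algebra: a homomorphism into the group of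
`*`-automorphisms that is continuous in the point-norm topology. -/
structure CStarAction (G : Type*) [Group G] [TopologicalSpace G]
    (A : Type*) [NonUnitalCStarAlgebra A] where
  /-- the underlying group homomorphism -/
  toHom : G →* (A ≃⋆ₐ[ℂ] A)
  /-- point-norm continuity -/
  continuous_apply : ∀ a : A, Continuous fun g => toHom g a

/-- A `*`-automorphism of a C⋆-algebra as a continuous linear map. -/
def StarAlgEquiv.toCLMap {B : Type*} [NonUnitalCStarAlgebra B] (σ : B ≃⋆ₐ[ℂ] B) : B →L[ℂ] B where
  toFun := σ
  map_add' := map_add σ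
  map_smul' := map_smul σ
  cont := (NonUnitalStarAlgHom.isometry σ σ.injective).continuous

@[simp] theorem StarAlgEquiv.toCLMap_apply {B : Type*} [NonUnitalCStarAlgebra B]
    (σ : B ≃⋆ₐ[ℂ] B) (b : B) : σ.toCLMap b = σ b := rfl

/-- The canonical extension of a `*`-automorphism `σ` of `B` to the multiplier algebra: it sends
the double centralizer `(L, R)` to `(σ ∘ L ∘ σ⁻¹, σ ∘ R ∘ σ⁻¹)`. -/
def multiplierExtension {B : Type*} [NonUnitalCStarAlgebra B] (σ : B ≃⋆ₐ[ℂ] B) :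
    𝓜(ℂ, B) →⋆ₐ[ℂ] 𝓜(ℂ, B) where
  toFun x :=
    { fst := (σ.toCLMap.comp x.fst).comp σ.symm.toCLMap
      snd := (σ.toCLMap.comp x.snd).comp σ.symm.toCLMap
      central := fun a b => by
        have h := congrArg σ (x.central (σ.symm a) (σ.symm b))
        simpa using h }
  map_one' := by ext b <;> simp
  map_mul' x y := by ext b <;> simp
  map_zero' := by ext b <;> simp
  map_add' x y := by ext b <;> simp
  commutes' c := by
    ext b <;> simp [Algebra.algebraMap_eq_smul_one]
  map_star' x := by
    ext b <;> simp [map_star]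

/-- The extension to the multiplier algebra restricts to the given automorphism on `B`. -/
theorem multiplierExtension_coe {B : Type*} [NonUnitalCStarAlgebra B] (σ : B ≃⋆ₐ[ℂ] B) (b : B) :
    multiplierExtension σ (b : 𝓜(ℂ, B)) = ((σ b : B) : 𝓜(ℂ, B)) := by
  ext c <;> simp [multiplierExtension]

/-- The copy of `B` inside its multiplier algebra. -/
def multiplierIdeal (B : Type*) [NonUnitalCStarAlgebra B] : Set 𝓜(ℂ, B) :=
  Set.range fun b : B => (b : 𝓜(ℂ, B))

/-- Continuity of a map into the multiplier algebra for the strict topology, which is generated by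
the seminorms `x ↦ ‖x b‖` and `x ↦ ‖b x‖` for `b` in `B`. -/
def StrictlyContinuous {X : Type*} [TopologicalSpace X] {B : Type*} [NonUnitalCStarAlgebra B]
    (f : X → 𝓜(ℂ, B)) : Prop :=
  ∀ b : B, (Continuous fun x => (f x).fst b) ∧ (Continuous fun x => (f x).snd b)

variable {G A B : Type*} [Group G] [TopologicalSpace G]
  [NonUnitalCStarAlgebra A] [NonUnitalCStarAlgebra B]

/-- The action extended to the multiplier algebra (not norm continuous in general). -/
def CStarAction.ext (β : CStarAction G B) (g : G) : 𝓜(ℂ, B) →⋆ₐ[ℂ] 𝓜(ℂ, B) :=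
  multiplierExtension (β.toHom g)

/-- A cocycle representation `(φ, u) : (A, α) → (M(B), β)`. -/
structure CocycleRep (α : CStarAction G A) (β : CStarAction G B) where
  /-- the `*`-homomorphism, not required to be nondegenerate -/
  φ : A →⋆ₙₐ[ℂ] 𝓜(ℂ, B)
  /-- the cocycle -/
  u : G → unitary 𝓜(ℂ, B)
  strictlyContinuous : StrictlyContinuous fun g => (u g : 𝓜(ℂ, B))
  cocycle : ∀ g h : G, (u (g * h) : 𝓜(ℂ, B)) = u g * β.ext g (u h)
  equivariant : ∀ (g : G) (a : A),
    (u g : 𝓜(ℂ, B)) * β.ext g (φ a) * star (u g : 𝓜(ℂ, B)) = φ (α.toHom g a)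

namespace CocycleRep

variable {α : CStarAction G A} {β : CStarAction G B}

/-- The cocycle perturbed action `x ↦ u_g β_g(x) u_g⋆` on the multiplier algebra. -/
def perturbed (ρ : CocycleRep α β) (g : G) (x : 𝓜(ℂ, B)) : 𝓜(ℂ, B) :=
  (ρ.u g : 𝓜(ℂ, B)) * β.ext g x * star (ρ.u g : 𝓜(ℂ, B))

/-- The (underlying set of the) C⋆-algebra `D_{(φ,u)}`: all multipliers that are invariant modulo
`B` under the perturbed action and commute modulo `B` with the range of `φ`. -/
def D (ρ : CocycleRep α β) : Set 𝓜(ℂ, B) :=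
  {x | ∀ g : G, x - ρ.perturbed g x ∈ multiplierIdeal B} ∩
    {x | ∀ a : A, x * ρ.φ a - ρ.φ a * x ∈ multiplierIdeal B}

/-- The path `U` asymptotically conjugates `(φ, u)` to `(ψ, v)`: one has `U_t φ(a) U_t⋆ → ψ(a)` in
norm for every `a`, and `U_t u_g β_g(U_t)⋆ → v_g` in norm, uniformly for `g` in compact sets. -/
def AsymptoticallyConjugates (ρ σ : CocycleRep α β) (U : ℝ≥0 → unitary 𝓜(ℂ, B)) : Prop :=
  (∀ a : A, Tendsto
    (fun t => ‖σ.φ a - (U t : 𝓜(ℂ, B)) * ρ.φ a * star (U t : 𝓜(ℂ, B))‖) atTop (𝓝 0)) ∧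
  ∀ K : Set G, IsCompact K → ∀ ε : ℝ, 0 < ε → ∀ᶠ t in atTop, ∀ g ∈ K,
    ‖(σ.u g : 𝓜(ℂ, B)) - (U t : 𝓜(ℂ, B)) * ρ.u g * star (β.ext g (U t))‖ ≤ ε

/-- Strong asymptotic unitary equivalence: there is a norm-continuous path of unitaries
`v : [0,∞) → U(1+B)` with `v_0 = 1` asymptotically conjugating one to the other. Here `U(1+B)` is
realised inside the multiplier algebra, as the unitaries `x` with `x - 1` in `B`. -/
def StronglyAsymptoticallyUnitarilyEquivalent (ρ σ : CocycleRep α β) : Prop :=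
  ∃ v : ℝ≥0 → unitary 𝓜(ℂ, B), Continuous v ∧
    (∀ t, (v t : 𝓜(ℂ, B)) - 1 ∈ multiplierIdeal B) ∧ v 0 = 1 ∧ ρ.AsymptoticallyConjugates σ v

end CocycleRep

end

/-! Write `I` for the copy of `B` in its multiplier algebra and `γ` for the perturbed action. It
suffices to find a norm-continuous path of unitaries `w` with `w 0 = 1` and `w t - U t ∈ I` that
asymptotically commutes with the range of `φ` and is asymptotically `γ`-invariant, uniformly on
compact sets. Then `v t = U t * star (w t)` lies in `1 + B` and conjugates as `U` does in the limit.

To obtain `w`, compress `U` by `c = 1 - z`, where `z t ∈ I` is a path of approximate units that is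
quasicentral for `φ` and `γ`. All defects of `U` lie in `I`, hence are killed by `c` in the limit,
while `c` itself is asymptotically central and invariant. Compression does not preserve unitaries,
so `U` is cut into factors within distance one of `1`. Each factor is the Cayley transform of a
selfadjoint contraction `k`, and the Cayley transform of `c * k * c` is again unitary and agrees
with the factor modulo `I`. Up to time `t` finitely many factors matter, and `z` is chosen so good
that their errors add up to something tending to zero.

Commutation with `φ a` and invariance under `γ_g` are both the vanishing of a twisted commutator `m
τ(y) - y m`, so one argument serves for both. The main steps are
`IdealAction.quasicentralSet_nonempty`, `IdealAction.continuous_apply_of_sub_mem` (needed for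
compactness of the set of defects) and `IdealAction.exists_asymptotically_central_path`. -/

/-! ### Twisted commutators as twisted derivations. -/

section TwistedCommutator

variable {M : Type*} [CStarAlgebra M]

/-- The twisted commutator `y ↦ m τ(y) - y m`. For `τ = id` it is a commutator with `m`, and for
`m = 1` it measures the failure of invariance under `τ`. -/
noncomputable def twistedComm (τ : M →⋆ₐ[ℂ] M) (m : M) : M →ₗ[ℂ] M where
  toFun y := m * τ y - y * m
  map_add' x y := by simp only [map_add, mul_add, add_mul]; abel
  map_smul' c x := by simp [smul_sub]

theorem twistedComm_apply (τ : M →⋆ₐ[ℂ] M) (m y : M) :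
    twistedComm τ m y = m * τ y - y * m := rfl

@[simp] theorem twistedComm_one (τ : M →⋆ₐ[ℂ] M) (m : M) : twistedComm τ m 1 = 0 := by
  simp [twistedComm_apply]

/-- The twisted Leibniz rule: all later estimates for inverses, Cayley transforms, compressions and
products come from it. -/
theorem twistedComm_mul (τ : M →⋆ₐ[ℂ] M) (m x y : M) :
    twistedComm τ m (x * y) = twistedComm τ m x * τ y + x * twistedComm τ m y := by
  simp only [twistedComm_apply, map_mul]; noncomm_ring

theorem twistedComm_inv (τ : M →⋆ₐ[ℂ] M) (m : M) {x y : M} (hxy : x * y = 1) (hyx : y * x = 1) :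
    twistedComm τ m y = -(y * twistedComm τ m x * τ y) := by
  have h := twistedComm_mul τ m x y
  rw [hxy, twistedComm_one] at h
  have h2 : y * (twistedComm τ m x * τ y + x * twistedComm τ m y) = 0 := by rw [← h, mul_zero]
  rw [mul_add, ← mul_assoc, ← mul_assoc, hyx, one_mul] at h2
  rw [eq_neg_iff_add_eq_zero, add_comm, h2]

theorem norm_twistedComm_mul_le (τ : M →⋆ₐ[ℂ] M) (m x y : M) :
    ‖twistedComm τ m (x * y)‖ ≤ ‖twistedComm τ m x‖ * ‖y‖ + ‖x‖ * ‖twistedComm τ m y‖ := by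
  rw [twistedComm_mul]
  refine (norm_add_le _ _).trans (add_le_add ((norm_mul_le _ _).trans ?_) (norm_mul_le _ _))
  gcongr
  exact NonUnitalStarAlgHom.norm_apply_le τ y

theorem norm_twistedComm_le (τ : M →⋆ₐ[ℂ] M) (m y : M) :
    ‖twistedComm τ m y‖ ≤ 2 * ‖m‖ * ‖y‖ := by
  rw [twistedComm_apply]
  have h1 := norm_mul_le m (τ y)
  have h2 := norm_mul_le y m
  have h3 := norm_sub_le (m * τ y) (y * m)
  have h4 : ‖m‖ * ‖τ y‖ ≤ ‖m‖ * ‖y‖ := by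
    gcongr; exact NonUnitalStarAlgHom.norm_apply_le τ y
  linarith

end TwistedCommutator

/-! ### The Cayley transform and its inverse near the identity. -/

section Cayley

variable {M : Type*} [CStarAlgebra M]

theorem ringInverse_eq {R : Type*} [Ring R] {x y : R} (hxy : x * y = 1) (hyx : y * x = 1) :
    Ring.inverse x = y :=
  Ring.inverse_unit ⟨x, y, hxy, hyx⟩

/-- The resolvent `(1 - i k)⁻¹`. -/
noncomputable def resolventI (k : M) : M := Ring.inverse (1 - Complex.I • k)

theorem IsSelfAdjoint.isUnit_one_sub_I_smul {k : M} (hk : IsSelfAdjoint k) :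
    IsUnit (1 - Complex.I • k) := by
  have h : -Complex.I ∉ spectrum ℂ k := fun h => by
    have := congrArg Complex.im (hk.mem_spectrum_eq_re h)
    simp at this
  rw [spectrum.notMem_iff] at h
  have e : (1 - Complex.I • k : M) = algebraMap ℂ M Complex.I * (algebraMap ℂ M (-Complex.I) - k) := by
    rw [mul_sub, ← map_mul, ← Algebra.smul_def]
    simp
  rw [e]
  exact ((isUnit_iff_ne_zero.2 Complex.I_ne_zero).map (algebraMap ℂ M)).mul h

theorem one_sub_mul_resolventI {k : M} (hk : IsSelfAdjoint k) :
    (1 - Complex.I • k) * resolventI k = 1 :=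
  Ring.mul_inverse_cancel _ hk.isUnit_one_sub_I_smul

theorem resolventI_mul_one_sub {k : M} (hk : IsSelfAdjoint k) :
    resolventI k * (1 - Complex.I • k) = 1 :=
  Ring.inverse_mul_cancel _ hk.isUnit_one_sub_I_smul

/-- The Cayley transform `(1 + i k) (1 - i k)⁻¹`. -/
noncomputable def cayley (k : M) : M := 2 * resolventI k - 1

theorem star_resolventI_mul {k : M} (hk : IsSelfAdjoint k) :
    star (resolventI k) * (1 + Complex.I • k) = 1 := by
  have h := congrArg star (one_sub_mul_resolventI hk)
  simpa [hk.star_eq] using h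

theorem mul_star_resolventI {k : M} (hk : IsSelfAdjoint k) :
    (1 + Complex.I • k) * star (resolventI k) = 1 := by
  have h := congrArg star (resolventI_mul_one_sub hk)
  simpa [hk.star_eq] using h

/-- With `r` the resolvent, the sum of `1 - i k` and `1 + i k` is `2`. Sandwiching this between
`star r` and `r`, in either order, gives `r + star r = 2 (star r * r) = 2 (r * star r)`. -/
theorem cayley_mem_unitary {k : M} (hk : IsSelfAdjoint k) : cayley k ∈ unitary M := by
  set r := resolventI k with hr
  have e2 : ∀ x y : M, x * (1 - Complex.I • k) * y + x * (1 + Complex.I • k) * y = 2 * (x * y) := by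
    intro x y; noncomm_ring
  have h1 : r + star r = 2 * (star r * r) := by
    have := e2 (star r) r
    rw [mul_assoc, one_sub_mul_resolventI hk, star_resolventI_mul hk] at this
    rw [← this]; noncomm_ring
  have h2 : r + star r = 2 * (r * star r) := by
    have := e2 r (star r)
    rw [mul_assoc r (1 + _), mul_star_resolventI hk, resolventI_mul_one_sub hk] at this
    rw [← this]; noncomm_ring
  have hs : star (cayley k) = 2 * star r - 1 := by
    rw [cayley, two_mul, two_mul]; simp [hr]
  rw [Unitary.mem_iff, hs]
  constructor
  · calc (2 * star r - 1) * (2 * r - 1) = 2 * (2 * (star r * r)) - 2 * (r + star r) + 1 := by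
          noncomm_ring
      _ = 1 := by rw [h1]; noncomm_ring
  · calc (2 * r - 1) * (2 * star r - 1) = 2 * (2 * (r * star r)) - 2 * (r + star r) + 1 := by
          noncomm_ring
      _ = 1 := by rw [h2]; noncomm_ring

theorem resolventI_eq (k : M) : resolventI k = (2⁻¹ : ℂ) • (cayley k + 1) := by
  rw [cayley, sub_add_cancel, two_mul, ← two_smul ℂ, smul_smul]; norm_num

theorem norm_unitary_le_one {x : M} (hx : x ∈ unitary M) : ‖x‖ ≤ 1 := by
  have h := CStarRing.norm_star_mul_self (x := x)
  rw [Unitary.star_mul_self_of_mem hx] at h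
  rcases subsingleton_or_nontrivial M with hM | hM
  · rw [Subsingleton.elim x 0]; simp
  · rw [CStarRing.norm_one] at h
    nlinarith [norm_nonneg x]

theorem norm_one_le_one : ‖(1 : M)‖ ≤ 1 := norm_unitary_le_one (one_mem _)

theorem norm_resolventI_le {k : M} (hk : IsSelfAdjoint k) : ‖resolventI k‖ ≤ 1 := by
  rw [resolventI_eq, norm_smul]
  have h := norm_add_le (cayley k) 1
  have h1 := norm_unitary_le_one (cayley_mem_unitary hk)
  have h2 := norm_one_le_one (M := M)
  norm_num
  linarith

/-- The derivation rule for inverses turns the twisted commutator of `2 r - 1` into `2 r (i T k)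
τ(r)`, and the resolvent `r` is a contraction. -/
theorem norm_twistedComm_cayley_le (τ : M →⋆ₐ[ℂ] M) (m : M) {k : M} (hk : IsSelfAdjoint k) :
    ‖twistedComm τ m (cayley k)‖ ≤ 2 * ‖twistedComm τ m k‖ := by
  have h : twistedComm τ m (cayley k) =
      (2 : ℂ) • (resolventI k * (Complex.I • twistedComm τ m k) * τ (resolventI k)) := by
    rw [cayley, map_sub, twistedComm_one, sub_zero, two_mul, ← two_smul ℂ, map_smul,
      twistedComm_inv τ m (one_sub_mul_resolventI hk) (resolventI_mul_one_sub hk), map_sub,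
      twistedComm_one, map_smul]
    simp
  have hr := norm_resolventI_le hk
  rw [h, norm_smul, Complex.norm_ofNat]
  gcongr
  refine (norm_mul_le _ _).trans ?_
  have h1 : ‖τ (resolventI k)‖ ≤ 1 := (NonUnitalStarAlgHom.norm_apply_le τ _).trans hr
  calc _ ≤ (1 * ‖twistedComm τ m k‖) * 1 := by
        gcongr
        refine (norm_mul_le _ _).trans ?_
        rw [norm_smul, Complex.norm_I, one_mul]
        exact mul_le_of_le_one_left (norm_nonneg _) hr
    _ = _ := by ring

/-- This is the resolvent identity. -/
theorem cayley_sub_cayley_mem (I : TwoSidedIdeal M) {k l : M} (hk : IsSelfAdjoint k)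
    (hl : IsSelfAdjoint l) (h : k - l ∈ I) : cayley k - cayley l ∈ I := by
  have e : cayley k - cayley l =
      2 * Complex.I • (resolventI k * (k - l) * resolventI l) := by
    have : resolventI k * ((1 - Complex.I • l) - (1 - Complex.I • k)) * resolventI l =
        resolventI k - resolventI l := by
      rw [mul_sub, sub_mul, mul_assoc, one_sub_mul_resolventI hl, resolventI_mul_one_sub hk,
        mul_one, one_mul]
    rw [cayley, cayley, sub_sub_sub_cancel_right, ← mul_sub, ← this]
    congr 1
    rw [sub_sub_sub_cancel_left, ← smul_sub]
    simp
  rw [e, ← smul_one_mul]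
  exact I.mul_mem_left _ _ (I.mul_mem_left _ _ (I.mul_mem_right _ _ (I.mul_mem_left _ _ h)))

theorem continuousOn_cayley : ContinuousOn (cayley (M := M)) {k | IsSelfAdjoint k} := by
  intro k hk
  refine ContinuousAt.continuousWithinAt ?_
  have h : ContinuousAt Ring.inverse (1 - Complex.I • k) := by
    obtain ⟨u, hu⟩ := IsSelfAdjoint.isUnit_one_sub_I_smul (k := k) hk
    rw [← hu]; exact NormedRing.inverse_continuousAt u
  have h' : ContinuousAt (fun k : M => Ring.inverse (1 - Complex.I • k)) k :=
    ContinuousAt.comp (f := fun k : M => 1 - Complex.I • k) h (by fun_prop)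
  unfold cayley resolventI
  fun_prop

/-- The inverse Cayley transform `-i (v - 1) (v + 1)⁻¹`. -/
noncomputable def invCayley (v : M) : M := Complex.I • (2 * Ring.inverse (v + 1) - 1)

theorem isUnit_add_one {v : M} (hv : ‖v - 1‖ ≤ 1) : IsUnit (v + 1) := by
  have h : ‖(2⁻¹ : ℂ) • (1 - v)‖ < 1 := by
    rw [norm_smul, norm_sub_rev]; norm_num; linarith
  have h2 := isUnit_one_sub_of_norm_lt_one h
  have e : v + 1 = algebraMap ℂ M 2 * (1 - (2⁻¹ : ℂ) • (1 - v)) := by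
    rw [← Algebra.smul_def, smul_sub, smul_smul, two_smul]; norm_num; rw [← one_add_one_eq_two]; abel
  rw [e]
  exact ((isUnit_iff_ne_zero.2 two_ne_zero).map (algebraMap ℂ M)).mul h2

theorem one_sub_I_smul_invCayley (v : M) :
    1 - Complex.I • invCayley v = (2 : ℂ) • Ring.inverse (v + 1) := by
  rw [invCayley, smul_smul, Complex.I_mul_I, two_smul, two_mul]; simp

theorem cayley_invCayley {v : M} (hv : ‖v - 1‖ ≤ 1) : cayley (invCayley v) = v := by
  obtain ⟨u, hu⟩ := isUnit_add_one hv
  have : Ring.inverse ((2 : ℂ) • Ring.inverse (v + 1)) = (2⁻¹ : ℂ) • (v + 1) := by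
    rw [← hu, Ring.inverse_unit]
    exact ringInverse_eq (by simp [smul_smul]) (by simp [smul_smul])
  rw [cayley, resolventI, one_sub_I_smul_invCayley, this, two_mul, ← two_smul ℂ, smul_smul]
  norm_num

/-- For `s = (v + 1)⁻¹`, unitarity gives `star s = v s = 1 - s`, so `2 s - 1` is skew-adjoint. -/
theorem isSelfAdjoint_invCayley {v : M} (hv : ‖v - 1‖ ≤ 1) (hu : v ∈ unitary M) :
    IsSelfAdjoint (invCayley v) := by
  have hunit := isUnit_add_one hv
  set s := Ring.inverse (v + 1) with hs
  have h1 : s * (v + 1) = 1 := Ring.inverse_mul_cancel _ hunit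
  have h2 : (v + 1) * s = 1 := Ring.mul_inverse_cancel _ hunit
  have h3 : star s = v * s := by
    have h4 : star s * (star v + 1) = 1 := by
      simpa using congrArg star h2
    have h5 : (star v + 1) * (v * s) = 1 := by
      rw [← mul_assoc, add_mul, Unitary.star_mul_self_of_mem hu, one_mul, add_comm, h2]
    calc star s = star s * ((star v + 1) * (v * s)) := by rw [h5, mul_one]
      _ = v * s := by rw [← mul_assoc, h4, one_mul]
  have h6 : star s = 1 - s := by
    rw [h3, ← h2]; noncomm_ring
  rw [IsSelfAdjoint, invCayley, ← hs, two_mul]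
  simp only [star_smul, star_sub, star_add, star_one, h6]
  rw [show star Complex.I = -Complex.I from Complex.conj_I, neg_smul, ← smul_neg]
  congr 1; abel

/-- For `y = 2 (v + 1)⁻¹ - 1` one has `2 y = (1 - v) - (v - 1) y`, hence `2 ‖y‖ ≤ 1 + ‖y‖`. -/
theorem norm_invCayley_le {v : M} (hv : ‖v - 1‖ ≤ 1) : ‖invCayley v‖ ≤ 1 := by
  have h2 : (v + 1) * Ring.inverse (v + 1) = 1 := Ring.mul_inverse_cancel _ (isUnit_add_one hv)
  rw [invCayley, norm_smul, Complex.norm_I, one_mul]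
  set y := 2 * Ring.inverse (v + 1) - 1 with hy
  have h3 : (2 : ℂ) • y = (1 - v) - (v - 1) * y := by
    have : (v + 1) * y = 1 - v := by
      calc (v + 1) * y = 2 * ((v + 1) * Ring.inverse (v + 1)) - (v + 1) := by
            rw [hy]; noncomm_ring
        _ = 1 - v := by rw [h2]; noncomm_ring
    rw [← this, two_smul]; noncomm_ring
  have h4 := congrArg norm h3
  rw [norm_smul, Complex.norm_ofNat] at h4
  have h5 := norm_sub_le (1 - v) ((v - 1) * y)
  have h6 := norm_mul_le (v - 1) y
  rw [norm_sub_rev 1 v] at h5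
  nlinarith [norm_nonneg y]

theorem twistedComm_invCayley_mem (I : TwoSidedIdeal M) (τ : M →⋆ₐ[ℂ] M) (m : M) {v : M}
    (hv : ‖v - 1‖ ≤ 1) (h : twistedComm τ m v ∈ I) : twistedComm τ m (invCayley v) ∈ I := by
  have hunit := isUnit_add_one hv
  rw [invCayley, map_smul, map_sub, twistedComm_one, two_mul, map_add, sub_zero, ← smul_one_mul,
    twistedComm_inv τ m (Ring.mul_inverse_cancel _ hunit) (Ring.inverse_mul_cancel _ hunit),
    map_add, twistedComm_one, add_zero]
  have := I.neg_mem (I.mul_mem_right _ (τ (Ring.inverse (v + 1)))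
    (I.mul_mem_left (Ring.inverse (v + 1)) _ h))
  exact I.mul_mem_left _ _ (I.add_mem this this)

theorem continuousOn_invCayley : ContinuousOn (invCayley (M := M)) {v | ‖v - 1‖ ≤ 1} := by
  intro v hv
  refine ContinuousAt.continuousWithinAt ?_
  have h : ContinuousAt Ring.inverse (v + 1) := by
    obtain ⟨u, hu⟩ := isUnit_add_one hv
    rw [← hu]; exact NormedRing.inverse_continuousAt u
  have h' : ContinuousAt (fun k : M => Ring.inverse (k + 1)) v :=
    ContinuousAt.comp (f := fun k : M => k + 1) h (by fun_prop)
  unfold invCayley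
  fun_prop

@[simp] theorem invCayley_one : invCayley (1 : M) = 0 := by
  have : (Ring.inverse (1 + 1) : M) = (2⁻¹ : ℂ) • 1 := by
    rw [← two_smul ℂ (1 : M)]
    exact ringInverse_eq (by simp [smul_smul]) (by simp [smul_smul])
  rw [invCayley, this, two_mul, ← two_smul ℂ, smul_smul]; norm_num

@[simp] theorem cayley_zero : cayley (0 : M) = 1 := by
  simp only [cayley, resolventI, smul_zero, sub_zero, Ring.inverse_one, mul_one]
  rw [← one_add_one_eq_two, add_sub_cancel_right]

end Cayley

/-! ### Quasicentral approximate units and automatic continuity of orbits. -/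

section IdealAction

variable {M : Type*} [CStarAlgebra M] {G : Type*} [Group G] [TopologicalSpace G]

/-- An action of `G` on a unital C⋆-algebra that leaves the ideal `I` invariant and is point-norm
continuous on `I` (but not necessarily on the whole algebra). -/
structure IdealAction (G : Type*) [Group G] [TopologicalSpace G] {M : Type*} [CStarAlgebra M]
    (I : TwoSidedIdeal M) where
  /-- the underlying family of endomorphisms -/
  toFun : G → M →⋆ₐ[ℂ] M
  map_one : ∀ x, toFun 1 x = x
  map_mul : ∀ g h x, toFun (g * h) x = toFun g (toFun h x)
  map_mem : ∀ g, ∀ b ∈ I, toFun g b ∈ I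
  continuous_apply : ∀ b ∈ I, Continuous fun g => toFun g b

/-- A sequence of selfadjoint contractions in `I` acting asymptotically as a unit on `I`. -/
structure IsApproxUnitSeq (I : TwoSidedIdeal M) (e : ℕ → M) : Prop where
  mem : ∀ n, e n ∈ I
  isSelfAdjoint : ∀ n, IsSelfAdjoint (e n)
  norm_le : ∀ n, ‖e n‖ ≤ 1
  tendsto_mul : ∀ b ∈ I, Tendsto (fun n => e n * b) atTop (𝓝 b)

theorem TwoSidedIdeal.real_smul_mem (I : TwoSidedIdeal M) (c : ℝ) {x : M} (hx : x ∈ I) :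
    c • x ∈ I := by
  rw [← smul_one_mul]; exact I.mul_mem_left _ _ hx

theorem TwoSidedIdeal.convex (I : TwoSidedIdeal M) : Convex ℝ {x : M | x ∈ I} :=
  fun _ hx _ hy a b _ _ _ => I.add_mem (I.real_smul_mem a hx) (I.real_smul_mem b hy)

open scoped Pointwise in
/-- Averages of a sufficiently sparse subsequence become small under a family of linear maps if
the images are asymptotically orthogonal. -/
theorem exists_mem_convex_forall_norm_le {X : Type*} (T : X → M →ₗ[ℂ] M) (e : ℕ → M) {C : ℝ}
    (hC : ∀ x k, ‖T x (e k)‖ ≤ C)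
    (horth : ∀ j, ∀ δ : ℝ, 0 < δ → ∀ᶠ k in atTop, ∀ x, ‖T x (e k) * star (T x (e j))‖ ≤ δ)
    {R : Set M} (hR : Convex ℝ R) (he : ∀ᶠ k in atTop, e k ∈ R) {ε : ℝ} (hε : 0 < ε) :
    ∃ z ∈ R, ∀ x, ‖T x z‖ ≤ ε := by
  obtain ⟨k₀, hk₀⟩ := he.exists
  -- Here `y` is a sum of `N` members of the sequence. Each new member is chosen so late that both
  -- cross terms have norm at most `1`, so the square grows by at most `C ^ 2 + 2`. Dividing by `N`
  -- leaves a norm of order `N ^ (-1/2)`.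
  have key : ∀ N : ℕ, ∃ y ∈ (N : ℝ) • R,
      (∀ δ : ℝ, 0 < δ → ∀ᶠ k in atTop, ∀ x, ‖T x (e k) * star (T x y)‖ ≤ δ) ∧
      ∀ x, ‖T x y‖ ^ 2 ≤ N * (C ^ 2 + 2) := by
    intro N
    induction N with
    | zero =>
      refine ⟨0, ⟨e k₀, hk₀, by simp⟩, fun δ hδ => ?_, fun x => by simp⟩
      exact Eventually.of_forall fun k x => by simp [hδ.le]
    | succ N ih =>
      obtain ⟨y, hyR, hy, hyn⟩ := ih
      obtain ⟨k, hk, hkR⟩ := ((hy 1 one_pos).and he).exists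
      refine ⟨y + e k, ?_, fun δ hδ => ?_, fun x => ?_⟩
      · rw [Nat.cast_succ, hR.add_smul (Nat.cast_nonneg _) zero_le_one, one_smul]
        exact Set.add_mem_add hyR hkR
      · filter_upwards [hy (δ / 2) (half_pos hδ), horth k (δ / 2) (half_pos hδ)] with l h1 h2 x
        rw [map_add, star_add, mul_add]
        exact (norm_add_le _ _).trans (by linarith [h1 x, h2 x])
      · have h1 := hyn x
        have h2 := hk x
        have h3 : ‖T x y * star (T x (e k))‖ ≤ 1 := by
          rw [← norm_star]; simpa using h2
        have h4 : ‖T x y * star (T x y)‖ = ‖T x y‖ ^ 2 := by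
          rw [CStarRing.norm_self_mul_star, sq]
        have h5 : ‖T x (e k) * star (T x (e k))‖ ≤ C ^ 2 := by
          rw [CStarRing.norm_self_mul_star, ← sq]
          exact pow_le_pow_left₀ (norm_nonneg _) (hC x k) 2
        have h6 : T x (y + e k) * star (T x (y + e k)) =
            T x y * star (T x y) + T x y * star (T x (e k)) + T x (e k) * star (T x y) +
              T x (e k) * star (T x (e k)) := by
          rw [map_add, star_add]; noncomm_ring
        rw [sq, ← CStarRing.norm_self_mul_star, h6]
        refine (norm_add_le _ _).trans ?_
        have h7 := norm_add_le (T x y * star (T x y) + T x y * star (T x (e k)))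
          (T x (e k) * star (T x y))
        have h8 := norm_add_le (T x y * star (T x y)) (T x y * star (T x (e k)))
        push_cast
        linarith
  obtain ⟨N, hN⟩ := exists_nat_gt ((C ^ 2 + 2) / ε ^ 2)
  have hN0 : (0 : ℝ) < N := lt_of_le_of_lt (by positivity) hN
  obtain ⟨y, ⟨z, hz, hzy⟩, -, hy⟩ := key N
  refine ⟨z, hz, fun x => ?_⟩
  have h1 := hy x
  have hzy' : y = ((N : ℝ) : ℂ) • z := by rw [← hzy]; exact (Complex.coe_smul _ _).symm
  rw [hzy', map_smul, norm_smul, Complex.norm_real, Real.norm_of_nonneg hN0.le] at h1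
  rw [div_lt_iff₀ (by positivity)] at hN
  have h2 : (N : ℝ) ^ 2 * ‖T x z‖ ^ 2 ≤ (N : ℝ) ^ 2 * ε ^ 2 := by
    nlinarith
  exact le_of_sq_le_sq (le_of_mul_le_mul_left h2 (by positivity)) hε.le

theorem IsApproxUnitSeq.eventually_norm_le {I : TwoSidedIdeal M} {e : ℕ → M}
    (he : IsApproxUnitSeq I e) {L : Set M} (hL : IsCompact L) (hLI : ∀ b ∈ L, b ∈ I) {δ : ℝ}
    (hδ : 0 < δ) : ∀ᶠ k in atTop, ∀ b ∈ L, ‖e k * b - b‖ ≤ δ := by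
  obtain ⟨t, htL, htf, hcov⟩ := hL.finite_cover_balls (show 0 < δ / 3 by positivity)
  have h1 : ∀ᶠ k in atTop, ∀ c ∈ t, ‖e k * c - c‖ < δ / 3 := by
    rw [htf.eventually_all]
    intro c hc
    have := (tendsto_iff_norm_sub_tendsto_zero.1 (he.tendsto_mul c (hLI c (htL hc))))
    exact this.eventually_lt_const (by positivity)
  filter_upwards [h1] with k hk b hb
  obtain ⟨c, hc, hbc⟩ := Set.mem_iUnion₂.1 (hcov hb)
  rw [mem_ball_iff_norm] at hbc
  have e1 : e k * b - b = e k * (b - c) + (e k * c - c) - (b - c) := by noncomm_ring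
  have h2 := norm_mul_le (e k) (b - c)
  have h3 := mul_le_of_le_one_left (norm_nonneg (b - c)) (he.norm_le k)
  have h4 := norm_sub_le (e k * (b - c) + (e k * c - c)) (b - c)
  have h5 := norm_add_le (e k * (b - c)) (e k * c - c)
  rw [e1]
  linarith [hk c hc]

namespace IdealAction

variable {I : TwoSidedIdeal M} (γ : IdealAction G I)

theorem apply_inv_apply (g : G) (x : M) : γ.toFun g (γ.toFun g⁻¹ x) = x := by
  rw [← γ.map_mul, mul_inv_cancel, γ.map_one]

theorem norm_apply (g : G) (x : M) : ‖γ.toFun g x‖ = ‖x‖ := by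
  refine le_antisymm (NonUnitalStarAlgHom.norm_apply_le _ _) ?_
  have := NonUnitalStarAlgHom.norm_apply_le (γ.toFun g⁻¹) (γ.toFun g x)
  rwa [← γ.map_mul, inv_mul_cancel, γ.map_one] at this

/-- Since each `γ_g` is isometric, joint continuity follows from continuity of single orbits. The
orbits of the values of `y` are a hypothesis because `γ` is only assumed point-norm continuous on
`I`. -/
theorem continuous_comp {X : Type*} [TopologicalSpace X] {y : X → M} {g : X → G}
    (hy : Continuous y) (hg : Continuous g) (h : ∀ x, Continuous fun g => γ.toFun g (y x)) :
    Continuous fun x => γ.toFun (g x) (y x) := by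
  rw [continuous_iff_continuousAt]
  intro x₀
  rw [ContinuousAt, tendsto_iff_norm_sub_tendsto_zero]
  have h1 : Tendsto (fun x => ‖y x - y x₀‖) (𝓝 x₀) (𝓝 0) :=
    tendsto_iff_norm_sub_tendsto_zero.1 hy.continuousAt
  have h2 : Tendsto (fun x => ‖γ.toFun (g x) (y x₀) - γ.toFun (g x₀) (y x₀)‖) (𝓝 x₀) (𝓝 0) :=
    tendsto_iff_norm_sub_tendsto_zero.1 ((h x₀).comp hg).continuousAt
  have h3 := h1.add h2
  rw [add_zero] at h3
  refine squeeze_zero (fun _ => norm_nonneg _) (fun x => ?_) h3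
  rw [← γ.norm_apply (g x) (y x - y x₀), map_sub]
  exact norm_sub_le_norm_sub_add_norm_sub _ _ _

/-- The approximately central elements of `I` for a family of twisted commutators that also act
approximately as a unit on `L`. -/
def quasicentralSet (Θ : Set (M × G)) (L : Set M) (ε : ℝ) : Set M :=
  {z | z ∈ I ∧ IsSelfAdjoint z ∧ ‖z‖ ≤ 1 ∧
    (∀ θ ∈ Θ, ‖twistedComm (γ.toFun θ.2) θ.1 z‖ ≤ ε) ∧ ∀ b ∈ L, ‖(1 - z) * b‖ ≤ ε}

theorem quasicentralSet_mono {Θ Θ' : Set (M × G)} {L L' : Set M} {ε ε' : ℝ} (hΘ : Θ ⊆ Θ')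
    (hL : L ⊆ L') (hε : ε' ≤ ε) : γ.quasicentralSet Θ' L' ε' ⊆ γ.quasicentralSet Θ L ε :=
  fun _ ⟨h1, h2, h3, h4, h5⟩ => ⟨h1, h2, h3, fun θ hθ => (h4 θ (hΘ hθ)).trans hε,
    fun b hb => (h5 b (hL hb)).trans hε⟩

theorem convex_quasicentralSet (Θ : Set (M × G)) (L : Set M) (ε : ℝ) :
    Convex ℝ (γ.quasicentralSet Θ L ε) := by
  rintro x ⟨x1, x2, x3, x4, x5⟩ y ⟨y1, y2, y3, y4, y5⟩ a b ha hb hab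
  have bound : ∀ (p q : M) (r : ℝ), ‖p‖ ≤ r → ‖q‖ ≤ r → ‖a • p + b • q‖ ≤ r := by
    intro p q r hp hq
    refine (norm_add_le _ _).trans ?_
    rw [norm_smul, norm_smul, Real.norm_of_nonneg ha, Real.norm_of_nonneg hb]
    calc _ ≤ a * r + b * r := by gcongr
      _ = r := by rw [← add_mul, hab, one_mul]
  refine ⟨I.convex x1 y1 ha hb hab, ((IsSelfAdjoint.all a).smul x2).add
    ((IsSelfAdjoint.all b).smul y2), bound _ _ _ x3 y3, fun θ hθ => ?_, fun c hc => ?_⟩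
  · have : twistedComm (γ.toFun θ.2) θ.1 (a • x + b • y) =
        a • twistedComm (γ.toFun θ.2) θ.1 x + b • twistedComm (γ.toFun θ.2) θ.1 y := by
      simp only [map_add, ← Complex.coe_smul a, ← Complex.coe_smul b, map_smul]
    rw [this]
    exact bound _ _ _ (x4 θ hθ) (y4 θ hθ)
  · have : (1 - (a • x + b • y)) * c = a • ((1 - x) * c) + b • ((1 - y) * c) := by
      rw [← smul_mul_assoc, ← smul_mul_assoc, ← add_mul]
      congr 1
      rw [smul_sub, smul_sub, sub_add_sub_comm, ← add_smul, hab, one_smul]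
    rw [this]
    exact bound _ _ _ (x5 c hc) (y5 c hc)

theorem star_twistedComm_mem (g : G) (m : M) {b : M} (hb : b ∈ I) (hb' : IsSelfAdjoint b) :
    star (twistedComm (γ.toFun g) m b) ∈ I := by
  rw [twistedComm_apply, star_sub, star_mul, star_mul, ← map_star, hb'.star_eq]
  exact I.sub_mem (I.mul_mem_right _ _ (γ.map_mem g b hb)) (I.mul_mem_left _ _ hb)

variable [IsTopologicalGroup G]

/-- Convex combinations of late `e k` still act as a unit on `L`. Averaging makes their twisted
commutators small, provided these are asymptotically orthogonal, uniformly over the compact set `Θ`.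
-/
theorem quasicentralSet_nonempty {e : ℕ → M} (he : IsApproxUnitSeq I e) {Θ : Set (M × G)}
    (hΘ : IsCompact Θ) {L : Set M} (hL : IsCompact L) (hLI : ∀ b ∈ L, b ∈ I) {ε : ℝ}
    (hε : 0 < ε) : (γ.quasicentralSet Θ L ε).Nonempty := by
  obtain ⟨C, hC0, hC⟩ : ∃ C : ℝ, 0 < C ∧ ∀ θ ∈ Θ, ‖θ.1‖ ≤ C := by
    obtain ⟨C, hC⟩ := (hΘ.image continuous_fst).isBounded.exists_norm_le
    refine ⟨max C 1, by positivity, fun θ hθ => (hC _ ⟨θ, hθ, rfl⟩).trans (le_max_left _ _)⟩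
  have hbase : ∀ᶠ k in atTop, e k ∈ γ.quasicentralSet ∅ L ε := by
    filter_upwards [he.eventually_norm_le hL hLI hε] with k hk
    refine ⟨he.mem k, he.isSelfAdjoint k, he.norm_le k, by simp, fun b hb => ?_⟩
    rw [sub_mul, one_mul, norm_sub_rev]
    exact hk b hb
  suffices h : ∃ z ∈ γ.quasicentralSet ∅ L ε,
      ∀ θ : Θ, ‖twistedComm (γ.toFun θ.1.2) θ.1.1 z‖ ≤ ε by
    obtain ⟨z, ⟨z1, z2, z3, -, z5⟩, hz⟩ := h
    exact ⟨z, z1, z2, z3, fun θ hθ => hz ⟨θ, hθ⟩, z5⟩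
  refine exists_mem_convex_forall_norm_le
    (fun θ : Θ => twistedComm (γ.toFun θ.1.2) θ.1.1) e (C := 2 * C) ?_ ?_
    (γ.convex_quasicentralSet ∅ L ε) hbase hε
  · intro θ k
    refine (norm_twistedComm_le _ _ _).trans ?_
    have h1 := hC θ.1 θ.2
    have h2 := he.norm_le k
    calc _ ≤ 2 * C * 1 := by gcongr
      _ = _ := mul_one _
  · intro j δ hδ
    have hγe : Continuous fun g => γ.toFun g (e j) := γ.continuous_apply _ (he.mem j)
    set d : M × G → M := fun θ => star (twistedComm (γ.toFun θ.2) θ.1 (e j)) with hd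
    have hdI : ∀ θ, d θ ∈ I := fun θ => γ.star_twistedComm_mem _ _ (he.mem j) (he.isSelfAdjoint j)
    have hdc : Continuous d := by
      simp only [hd, twistedComm_apply]
      fun_prop
    have hdc' : Continuous fun θ : M × G => γ.toFun θ.2⁻¹ (d θ) :=
      γ.continuous_comp hdc (by fun_prop) fun θ => γ.continuous_apply _ (hdI θ)
    have hdc'' : Continuous fun θ : M × G => θ.1 * d θ := by fun_prop
    have h1 := he.eventually_norm_le (hΘ.image hdc')
      (by rintro _ ⟨θ, -, rfl⟩; exact γ.map_mem _ _ (hdI θ)) (show 0 < δ / (2 * C) by positivity)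
    have h2 := he.eventually_norm_le (hΘ.image hdc'')
      (by rintro _ ⟨θ, -, rfl⟩; exact I.mul_mem_left _ _ (hdI θ)) (show 0 < δ / 2 by positivity)
    filter_upwards [h1, h2] with k hk1 hk2 θ
    have a1 := hk1 _ ⟨θ.1, θ.2, rfl⟩
    have a2 := hk2 _ ⟨θ.1, θ.2, rfl⟩
    have a3 := hC θ.1 θ.2
    change ‖twistedComm (γ.toFun θ.1.2) θ.1.1 (e k) * d θ.1‖ ≤ δ
    generalize θ.1 = η at a1 a2 a3 ⊢
    -- The adjoint `d η` lies in `I`, so for large `k` both halves of the twisted commutator,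
    -- multiplied by `d η`, approach `η.1 * d η` and cancel.
    have e1 : twistedComm (γ.toFun η.2) η.1 (e k) * d η =
        η.1 * γ.toFun η.2 (e k * γ.toFun η.2⁻¹ (d η) - γ.toFun η.2⁻¹ (d η)) -
          (e k * (η.1 * d η) - η.1 * d η) := by
      rw [map_sub, _root_.map_mul, γ.apply_inv_apply, twistedComm_apply]; noncomm_ring
    rw [e1]
    refine (norm_sub_le _ _).trans ?_
    have a4 := norm_mul_le η.1 (γ.toFun η.2 (e k * γ.toFun η.2⁻¹ (d η) - γ.toFun η.2⁻¹ (d η)))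
    rw [γ.norm_apply] at a4
    have a5 : ‖η.1‖ * ‖e k * γ.toFun η.2⁻¹ (d η) - γ.toFun η.2⁻¹ (d η)‖ ≤ C * (δ / (2 * C)) := by
      gcongr
    have a6 : C * (δ / (2 * C)) = δ / 2 := by field_simp
    linarith

/-- If `γ_g(x) - x` lies in `I` for all `g`, then the orbit map of `x` is norm continuous. -/
theorem continuous_apply_of_sub_mem [LocallyCompactSpace G] {e : ℕ → M}
    (he : IsApproxUnitSeq I e) {x : M} (hx : ∀ g, γ.toFun g x - x ∈ I) :
    Continuous fun g => γ.toFun g x := by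
  set f : G → M := fun g => γ.toFun g x - x with hf
  -- The factor `e n` is moved inside the action, so that only orbits of elements of `I` occur. Thus
  -- `f` is a pointwise limit of continuous functions.
  have hfn : ∀ n, Continuous fun g => e n * f g := by
    intro n
    have h1 : Continuous fun g => γ.toFun g⁻¹ (e n) :=
      (γ.continuous_apply _ (he.mem n)).comp continuous_inv
    have h2 : Continuous fun g => γ.toFun g (γ.toFun g⁻¹ (e n) * x) :=
      γ.continuous_comp (by fun_prop) continuous_id fun g =>
        γ.continuous_apply _ (I.mul_mem_right _ _ (γ.map_mem _ _ (he.mem n)))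
    have h3 : (fun g => e n * f g) = fun g => γ.toFun g (γ.toFun g⁻¹ (e n) * x) - e n * x := by
      funext g
      rw [_root_.map_mul, γ.apply_inv_apply, hf, mul_sub]
    rw [h3]
    fun_prop
  have hone : Tendsto f (𝓝 1) (𝓝 0) := by
    rw [tendsto_zero_iff_norm_tendsto_zero, Metric.tendsto_nhds]
    intro ε hε
    -- Baire category: some `E N` has interior, and there `e N * f` approximates `f` uniformly.
    set E : ℕ → Set G := fun N => {g | ∀ m, N ≤ m → ‖e m * f g - e N * f g‖ ≤ ε / 5} with hE
    have hEc : ∀ N, IsClosed (E N) := by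
      intro N
      simp only [hE, Set.ofPred_forall]
      refine isClosed_iInter fun m => isClosed_iInter fun _ => ?_
      exact isClosed_le ((hfn m).sub (hfn N)).norm continuous_const
    have hEU : ⋃ N, E N = Set.univ := by
      refine Set.eq_univ_of_forall fun g => Set.mem_iUnion.2 ?_
      obtain ⟨N, hN⟩ := Metric.cauchySeq_iff'.1 (he.tendsto_mul (f g) (hx g)).cauchySeq (ε / 5)
        (by positivity)
      exact ⟨N, fun m hm => by rw [← dist_eq_norm]; exact (hN m hm).le⟩
    obtain ⟨N, g₀, hg₀⟩ := nonempty_interior_of_iUnion_of_closed hEc hEU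
    have hlim : ∀ g ∈ E N, ‖f g - e N * f g‖ ≤ ε / 5 := by
      intro g hg
      have h1 : Tendsto (fun m => ‖e m * f g - e N * f g‖) atTop (𝓝 ‖f g - e N * f g‖) :=
        ((he.tendsto_mul (f g) (hx g)).sub_const _).norm
      exact le_of_tendsto h1 (eventually_atTop.2 ⟨N, fun m hm => hg m hm⟩)
    have hmul : Tendsto (fun h : G => g₀ * h) (𝓝 1) (𝓝 g₀) := by
      have : Continuous fun h : G => g₀ * h := by fun_prop
      simpa using this.tendsto 1
    have hA := hmul.eventually (isOpen_interior.mem_nhds hg₀)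
    have hB : ∀ᶠ g in 𝓝 g₀, ‖e N * f g - e N * f g₀‖ < ε / 5 := by
      have := tendsto_iff_norm_sub_tendsto_zero.1 ((hfn N).tendsto g₀)
      exact this.eventually_lt_const (by positivity)
    filter_upwards [hA, hmul.eventually hB] with h h1 h2
    have h3 := hlim _ (interior_subset h1)
    have h4 := hlim _ (interior_subset hg₀)
    -- The cocycle identity `f (g₀ h) = γ_{g₀} (f h) + f g₀` moves the estimate near `g₀` to the
    -- identity of the group.
    have h5 : ‖f h‖ = ‖f (g₀ * h) - f g₀‖ := by
      rw [← γ.norm_apply g₀]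
      congr 1
      simp only [hf, map_sub, γ.map_mul]; abel
    have h6 : f (g₀ * h) - f g₀ = (f (g₀ * h) - e N * f (g₀ * h)) +
        (e N * f (g₀ * h) - e N * f g₀) - (f g₀ - e N * f g₀) := by abel
    rw [dist_zero_right, norm_norm, h5, h6]
    have h7 := norm_sub_le ((f (g₀ * h) - e N * f (g₀ * h)) +
        (e N * f (g₀ * h) - e N * f g₀)) (f g₀ - e N * f g₀)
    have h8 := norm_add_le (f (g₀ * h) - e N * f (g₀ * h)) (e N * f (g₀ * h) - e N * f g₀)
    linarith
  rw [continuous_iff_continuousAt]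
  intro g
  rw [ContinuousAt, tendsto_iff_norm_sub_tendsto_zero]
  have hmul : Tendsto (fun h : G => g⁻¹ * h) (𝓝 g) (𝓝 1) := by
    have : Continuous fun h : G => g⁻¹ * h := by fun_prop
    simpa using this.tendsto g
  refine (tendsto_zero_iff_norm_tendsto_zero.1 (hone.comp hmul)).congr fun h => ?_
  rw [Function.comp_apply, ← γ.norm_apply g]
  congr 1
  simp only [hf]
  rw [map_sub, ← γ.map_mul, mul_inv_cancel_left]

end IdealAction

end IdealAction

/-! ### Cutting the path into small factors, compressing them and multiplying back. -/

section PathLifting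

/-- A continuous path on `[0,∞)` admits a partition of `[0,∞)` on each piece of which it varies
by at most one. -/
theorem exists_partition_dist_le {E : Type*} [PseudoMetricSpace E] {U : ℝ≥0 → E}
    (hU : Continuous U) :
    ∃ T : ℕ → ℝ≥0, T 0 = 0 ∧ Monotone T ∧ Tendsto T atTop atTop ∧
      ∀ j s, T j ≤ s → s ≤ T (j + 1) → dist (U s) (U (T j)) ≤ 1 := by
  have h : ∀ n : ℕ, ∃ δ : ℝ≥0, 0 < δ ∧ δ ≤ 1 ∧ ∀ s s' : ℝ≥0, s ≤ n + 1 → s' ≤ n + 1 →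
      dist s s' ≤ δ → dist (U s) (U s') ≤ 1 := by
    intro n
    have hc : UniformContinuousOn U (Set.Icc 0 ((n : ℝ≥0) + 1)) :=
      isCompact_Icc.uniformContinuousOn_of_continuous hU.continuousOn
    obtain ⟨δ, hδ, h⟩ := Metric.uniformContinuousOn_iff_le.1 hc 1 one_pos
    refine ⟨min δ.toNNReal 1, by positivity, min_le_right _ _, fun s s' hs hs' hd => ?_⟩
    refine h s ⟨zero_le, hs⟩ s' ⟨zero_le, hs'⟩ (hd.trans ?_)
    calc ((min δ.toNNReal 1 : ℝ≥0) : ℝ) ≤ (δ.toNNReal : ℝ) := by exact_mod_cast min_le_left _ _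
      _ = δ := Real.coe_toNNReal _ hδ.le
  choose δ hδ0 hδ1 hδ using h
  -- The modulus `δ n` serves on `[0, n + 1]`. As `δ n ≤ 1`, a step starting below `n` stays in that
  -- interval.
  set T : ℕ → ℝ≥0 := fun n => Nat.rec 0 (fun _ s => s + δ ⌈s⌉₊) n with hT
  have hTs : ∀ n, T (n + 1) = T n + δ ⌈T n⌉₊ := fun n => rfl
  have hmono : Monotone T := monotone_nat_of_le_succ fun n => by rw [hTs]; exact le_self_add
  refine ⟨T, rfl, hmono, tendsto_atTop_atTop_of_monotone hmono fun b => ?_, fun j s h1 h2 => ?_⟩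
  -- If `T` stayed below `b`, all steps would be at least the minimum of finitely many positive
  -- numbers.
  · by_contra! hb
    obtain ⟨i, -, hi⟩ := Finset.exists_min_image (Finset.range (⌈b⌉₊ + 1)) δ ⟨0, by simp⟩
    have hlow : ∀ n : ℕ, n * δ i ≤ T n := by
      intro n
      induction n with
      | zero => simp
      | succ n ih =>
        rw [hTs, Nat.cast_succ, add_mul, one_mul]
        refine add_le_add ih (hi _ ?_)
        rw [Finset.mem_range, Nat.lt_succ_iff]
        exact Nat.ceil_mono (hb n).le
    obtain ⟨n, hn⟩ := exists_nat_gt (b / δ i)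
    rw [div_lt_iff₀ (hδ0 i)] at hn
    exact absurd (hn.trans_le (hlow n)) (hb n).not_gt
  · have h3 : s ≤ T j + δ ⌈T j⌉₊ := h2
    have h4 : T j ≤ ⌈T j⌉₊ := Nat.le_ceil _
    refine hδ ⌈T j⌉₊ s (T j) (h3.trans (add_le_add h4 (hδ1 _))) (h4.trans le_self_add) ?_
    rw [NNReal.dist_eq, abs_of_nonneg (sub_nonneg.2 (by exact_mod_cast h1)), sub_le_iff_le_add']
    exact_mod_cast h3

/-- A point of `S (⌈t⌉₊ + 1)` is an admissible constant value on the whole neighbourhood `[0, t +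
1)` of `t`. Convexity allows these local choices to be glued. -/
theorem exists_continuous_mem_of_antitone {E : Type*} [NormedAddCommGroup E] [NormedSpace ℝ E]
    {S : ℕ → Set E} (hS : Antitone S) (hconv : ∀ n, Convex ℝ (S n)) (hne : ∀ n, (S n).Nonempty) :
    ∃ z : ℝ≥0 → E, Continuous z ∧ ∀ t, z t ∈ S ⌈t⌉₊ := by
  obtain ⟨z, hz⟩ := exists_continuous_forall_mem_convex_of_local_const
    (t := fun t : ℝ≥0 => S ⌈t⌉₊) (fun t => hconv _) fun t => by
      obtain ⟨c, hc⟩ := hne (⌈t⌉₊ + 1)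
      refine ⟨c, ?_⟩
      filter_upwards [Iio_mem_nhds (lt_add_one t)] with y hy
      refine hS ?_ hc
      rw [Nat.ceil_le, Nat.cast_succ]
      exact (le_of_lt hy).trans (add_le_add_left (Nat.le_ceil t) 1)
  exact ⟨z, z.continuous, hz⟩

variable {M : Type*} [CStarAlgebra M]

/-- The factor of a path `U` of unitaries that is responsible for the interval `[p, q]`. -/
noncomputable def pathFactor (U : ℝ≥0 → M) (p q t : ℝ≥0) : M :=
  U (max p (min t q)) * star (U p)

/-- The product of the first `n` members of a sequence, later members to the left. -/
def leftProd (f : ℕ → M) : ℕ → M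
  | 0 => 1
  | n + 1 => f n * leftProd f n

theorem leftProd_mem_unitary {f : ℕ → M} (hf : ∀ j, f j ∈ unitary M) (n : ℕ) :
    leftProd f n ∈ unitary M := by
  induction n with
  | zero => exact one_mem _
  | succ n ih => exact mul_mem (hf n) ih

theorem leftProd_sub_mem (I : TwoSidedIdeal M) {f g : ℕ → M} (h : ∀ j, f j - g j ∈ I) (n : ℕ) :
    leftProd f n - leftProd g n ∈ I := by
  induction n with
  | zero => simp [leftProd]
  | succ n ih =>
    have e : leftProd f (n + 1) - leftProd g (n + 1) =
        (f n - g n) * leftProd f n + g n * (leftProd f n - leftProd g n) := by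
      simp only [leftProd]; noncomm_ring
    rw [e]
    exact I.add_mem (I.mul_mem_right _ _ (h n)) (I.mul_mem_left _ _ ih)

theorem leftProd_eq_of_le {f : ℕ → M} {m n : ℕ} (hmn : m ≤ n) (h : ∀ j, m ≤ j → f j = 1) :
    leftProd f n = leftProd f m := by
  induction n, hmn using Nat.le_induction with
  | base => rfl
  | succ n hn ih => rw [leftProd, h n hn, one_mul, ih]

theorem norm_twistedComm_leftProd_le (τ : M →⋆ₐ[ℂ] M) (m : M) {f : ℕ → M}
    (hf : ∀ j, f j ∈ unitary M) {c : ℝ} {N : ℕ} (h : ∀ j < N, ‖twistedComm τ m (f j)‖ ≤ c) :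
    ‖twistedComm τ m (leftProd f N)‖ ≤ N * c := by
  induction N with
  | zero => simp [leftProd]
  | succ n ih =>
    rw [leftProd]
    refine (norm_twistedComm_mul_le _ _ _ _).trans ?_
    have h1 := ih fun j hj => h j (hj.trans n.lt_succ_self)
    have h2 := h n n.lt_succ_self
    have h3 := norm_unitary_le_one (leftProd_mem_unitary hf n)
    have h4 := norm_unitary_le_one (hf n)
    have h5 := mul_le_of_le_one_right (norm_nonneg (twistedComm τ m (f n))) h3
    have h6 := mul_le_of_le_one_left (norm_nonneg (twistedComm τ m (leftProd f n))) h4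
    push_cast
    linarith

theorem pathFactor_mem_unitary {U : ℝ≥0 → M} (hUu : ∀ t, U t ∈ unitary M)
    (p q t : ℝ≥0) : pathFactor U p q t ∈ unitary M :=
  mul_mem (hUu _) (Unitary.star_mem (hUu _))

theorem pathFactor_of_le {U : ℝ≥0 → M} (hUu : ∀ t, U t ∈ unitary M)
    {p t : ℝ≥0} (q : ℝ≥0) (ht : t ≤ p) : pathFactor U p q t = 1 := by
  rw [pathFactor, max_eq_left ((min_le_left _ _).trans ht), Unitary.mul_star_self_of_mem (hUu p)]

theorem norm_pathFactor_sub_one_le {U : ℝ≥0 → M} (hUu : ∀ t, U t ∈ unitary M)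
    {p q : ℝ≥0} (hpq : p ≤ q)
    (h : ∀ s, p ≤ s → s ≤ q → dist (U s) (U p) ≤ 1) (t : ℝ≥0) :
    ‖pathFactor U p q t - 1‖ ≤ 1 := by
  rw [pathFactor, ← Unitary.mul_star_self_of_mem (hUu p), ← sub_mul]
  refine (norm_mul_le _ _).trans ?_
  have h1 := h (max p (min t q)) (le_max_left _ _) (max_le hpq (min_le_right _ _))
  rw [dist_eq_norm] at h1
  have h2 := norm_unitary_le_one (Unitary.star_mem (hUu p))
  exact mul_le_one₀ h1 (norm_nonneg _) h2

theorem twistedComm_pathFactor_mem {U : ℝ≥0 → M} (hUu : ∀ t, U t ∈ unitary M)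
    (I : TwoSidedIdeal M) (τ : M →⋆ₐ[ℂ] M) (m : M)
    (h : ∀ t, twistedComm τ m (U t) ∈ I) (p q t : ℝ≥0) :
    twistedComm τ m (pathFactor U p q t) ∈ I := by
  rw [pathFactor, twistedComm_mul, twistedComm_inv τ m (Unitary.mul_star_self_of_mem (hUu p))
    (Unitary.star_mul_self_of_mem (hUu p))]
  exact I.add_mem (I.mul_mem_right _ _ (h _)) (I.mul_mem_left _ _ (I.neg_mem
    (I.mul_mem_right _ _ (I.mul_mem_left _ _ (h _)))))

/-- The product telescopes, and factors whose interval starts at or after `t` are `1`. -/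
theorem leftProd_pathFactor {U : ℝ≥0 → M} (hUu : ∀ t, U t ∈ unitary M)
    (hU0 : U 0 = 1) {T : ℕ → ℝ≥0} (hT0 : T 0 = 0) (hT : Monotone T)
    (n : ℕ) (t : ℝ≥0) :
    leftProd (fun j => pathFactor U (T j) (T (j + 1)) t) n = U (min t (T n)) := by
  induction n with
  | zero => simp [leftProd, hT0, hU0]
  | succ n ih =>
    rw [leftProd, ih]
    rcases le_total t (T n) with h | h
    · rw [pathFactor_of_le hUu _ h, one_mul, min_eq_left h,
        min_eq_left (h.trans (hT n.le_succ))]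
    · rw [min_eq_right h, pathFactor, mul_assoc, Unitary.star_mul_self_of_mem (hUu _), mul_one,
        max_eq_right (le_min h (hT n.le_succ))]

theorem continuous_pathFactor {U : ℝ≥0 → M} (hU : Continuous U) (p q : ℝ≥0) :
    Continuous (pathFactor U p q) := by
  unfold pathFactor; fun_prop

/-- By the Leibniz rule there are three terms, each at most `2 ε`. The bound on `c` is `2` because
`c = 1 - z` with `z` a selfadjoint contraction that need not be positive. -/
theorem norm_twistedComm_compress_le (τ : M →⋆ₐ[ℂ] M) (m : M) {k c : M} {ε : ℝ} (hk : ‖k‖ ≤ 1)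
    (hc : ‖c‖ ≤ 2) (h1 : ‖twistedComm τ m c‖ ≤ ε) (h2 : ‖c * twistedComm τ m k‖ ≤ ε) :
    ‖twistedComm τ m (c * k * c)‖ ≤ 6 * ε := by
  have hε : 0 ≤ ε := (norm_nonneg _).trans h1
  have e : twistedComm τ m (c * k * c) = twistedComm τ m c * τ k * τ c +
      c * twistedComm τ m k * τ c + c * k * twistedComm τ m c := by
    rw [twistedComm_mul, twistedComm_mul, add_mul]
  have hτk : ‖τ k‖ ≤ 1 := (NonUnitalStarAlgHom.norm_apply_le τ k).trans hk
  have hτc : ‖τ c‖ ≤ 2 := (NonUnitalStarAlgHom.norm_apply_le τ c).trans hc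
  have a1 : ‖twistedComm τ m c * τ k * τ c‖ ≤ ε * 1 * 2 :=
    norm_mul_le_of_le (norm_mul_le_of_le h1 hτk) hτc
  have a2 : ‖c * twistedComm τ m k * τ c‖ ≤ ε * 2 := norm_mul_le_of_le h2 hτc
  have a3 : ‖c * k * twistedComm τ m c‖ ≤ 2 * 1 * ε :=
    norm_mul_le_of_le (norm_mul_le_of_le hc hk) h1
  rw [e]
  refine (norm_add₃_le).trans ?_
  linarith

variable {G : Type*} [Group G] [TopologicalSpace G] [IsTopologicalGroup G] [LocallyCompactSpace G]

/-- A path of unitaries starting at `1` whose members are central modulo `I` can be perturbed by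
elements of `I` to a path of unitaries that is asymptotically central. -/
theorem IdealAction.exists_asymptotically_central_path {I : TwoSidedIdeal M}
    (γ : IdealAction G I) {e : ℕ → M} (he : IsApproxUnitSeq I e) {Θ : ℕ → Set (M × G)}
    (hΘc : ∀ n, IsCompact (Θ n)) (hΘ : Monotone Θ) {U : ℝ≥0 → M} (hU : Continuous U)
    (hUu : ∀ t, U t ∈ unitary M) (hU0 : U 0 = 1) (hUγ : ∀ t g, γ.toFun g (U t) - U t ∈ I)
    (hUΘ : ∀ t n, ∀ θ ∈ Θ n, twistedComm (γ.toFun θ.2) θ.1 (U t) ∈ I) :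
    ∃ w : ℝ≥0 → M, Continuous w ∧ (∀ t, w t ∈ unitary M) ∧ w 0 = 1 ∧ (∀ t, w t - U t ∈ I) ∧
      ∀ n, ∀ ε : ℝ, 0 < ε → ∀ᶠ t in atTop, ∀ θ ∈ Θ n,
        ‖twistedComm (γ.toFun θ.2) θ.1 (w t)‖ ≤ ε := by
  obtain ⟨T, hT0, hTm, hTt, hTU⟩ := exists_partition_dist_le hU
  set W : ℕ → ℝ≥0 → M := fun j => pathFactor U (T j) (T (j + 1)) with hW
  have hWu : ∀ j t, W j t ∈ unitary M := fun j t => pathFactor_mem_unitary hUu _ _ t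
  have hW1 : ∀ j t, ‖W j t - 1‖ ≤ 1 := fun j =>
    norm_pathFactor_sub_one_le hUu (hTm j.le_succ) (hTU j)
  set k : ℕ → ℝ≥0 → M := fun j t => invCayley (W j t) with hk
  have hkc : ∀ j, Continuous (k j) := fun j =>
    continuousOn_invCayley.comp_continuous (continuous_pathFactor hU _ _) (hW1 j)
  have hksa : ∀ j t, IsSelfAdjoint (k j t) := fun j t => isSelfAdjoint_invCayley (hW1 j t) (hWu j t)
  have hkn : ∀ j t, ‖k j t‖ ≤ 1 := fun j t => norm_invCayley_le (hW1 j t)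
  have hk0 : ∀ j t, t ≤ T j → k j t = 0 := fun j t ht => by
    simp only [hk, hW, pathFactor_of_le hUu _ ht, invCayley_one]
  have hkI : ∀ (τ : M →⋆ₐ[ℂ] M) (m : M), (∀ t, twistedComm τ m (U t) ∈ I) →
      ∀ j t, twistedComm τ m (k j t) ∈ I := fun τ m h j t =>
    twistedComm_invCayley_mem I τ m (hW1 j t) (twistedComm_pathFactor_mem hUu I τ m h _ _ t)
  -- The elements `k j t` need not lie in `I`; their orbits are continuous because they are
  -- invariant modulo `I`.
  have hkγ : ∀ j t, Continuous fun g => γ.toFun g (k j t) := fun j t =>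
    γ.continuous_apply_of_sub_mem he fun g => by
      have := hkI (γ.toFun g) 1 (fun t => by simpa [twistedComm_apply] using hUγ t g) j t
      simpa [twistedComm_apply] using this
  have hdc : ∀ j, Continuous fun p : ℝ≥0 × (M × G) =>
      twistedComm (γ.toFun p.2.2) p.2.1 (k j p.1) := by
    intro j
    have h1 : Continuous fun p : ℝ≥0 × (M × G) => γ.toFun p.2.2 (k j p.1) :=
      γ.continuous_comp ((hkc j).comp continuous_fst) (by fun_prop) fun p => hkγ j p.1
    have h2 : Continuous fun p : ℝ≥0 × (M × G) => k j p.1 := (hkc j).comp continuous_fst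
    simp only [twistedComm_apply]
    fun_prop
  obtain ⟨N, hNm, hN⟩ := extraction_forall_of_eventually
    fun n : ℕ => hTt.eventually_ge_atTop (n : ℝ≥0)
  -- All defects in `I` that matter up to time `n`. Since `T (N n) ≥ n`, factors of index at least
  -- `N n` are still trivial then.
  set L : ℕ → Set M := fun n => ⋃ j ∈ Finset.range (N n),
    (fun p : ℝ≥0 × (M × G) => twistedComm (γ.toFun p.2.2) p.2.1 (k j p.1)) ''
      (Set.Icc 0 (n : ℝ≥0) ×ˢ Θ n) with hL
  have hLc : ∀ n, IsCompact (L n) := fun n =>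
    (Finset.range (N n)).isCompact_biUnion fun j _ =>
      (isCompact_Icc.prod (hΘc n)).image (hdc j)
  have hLm : Monotone L := fun m n hmn =>
    Set.biUnion_mono (by simpa using hNm.monotone hmn) fun j _ => Set.image_mono
      (Set.prod_mono (Set.Icc_subset_Icc_right (by exact_mod_cast hmn)) (hΘ hmn))
  have hLI : ∀ n, ∀ b ∈ L n, b ∈ I := by
    intro n b hb
    simp only [hL, Set.mem_iUnion] at hb
    obtain ⟨j, -, p, hp, rfl⟩ := hb
    exact hkI _ _ (fun t => hUΘ t n p.2 hp.2) j p.1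
  -- Small enough that `N n` factors, each with error `12 η n`, have total error below `12 / (n +
  -- 1)`.
  set η : ℕ → ℝ := fun n => 1 / (((N n : ℝ) + 1) * ((n : ℝ) + 1)) with hη
  have hη0 : ∀ n, 0 < η n := fun n => by simp only [hη]; positivity
  have hηa : Antitone η := fun m n hmn => by
    have h1 : (N m : ℝ) ≤ N n := by exact_mod_cast hNm.monotone hmn
    have h2 : (m : ℝ) ≤ n := by exact_mod_cast hmn
    simp only [hη]
    gcongr
  obtain ⟨z, hzc, hz⟩ := exists_continuous_mem_of_antitone
    (S := fun n => γ.quasicentralSet (Θ n) (L n) (η n))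
    (fun m n hmn => γ.quasicentralSet_mono (hΘ hmn) (hLm hmn) (hηa hmn))
    (fun n => γ.convex_quasicentralSet _ _ _)
    fun n => γ.quasicentralSet_nonempty he (hΘc n) (hLc n) (hLI n) (hη0 n)
  set c : ℝ≥0 → M := fun t => 1 - z t with hc
  have hcsa : ∀ t, IsSelfAdjoint (c t) := fun t => (IsSelfAdjoint.one M).sub (hz t).2.1
  have hcn : ∀ t, ‖c t‖ ≤ 2 := fun t => by
    have h1 := norm_sub_le 1 (z t)
    have h2 := (hz t).2.2.1
    have h3 := norm_one_le_one (M := M)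
    simp only [hc]
    linarith
  have hcksa : ∀ j t, IsSelfAdjoint (c t * k j t * c t) := fun j t => by
    simpa [(hcsa t).star_eq] using (hksa j t).conjugate (c t)
  set q : ℕ → ℝ≥0 → M := fun j t => cayley (c t * k j t * c t) with hq
  have hqu : ∀ j t, q j t ∈ unitary M := fun j t => cayley_mem_unitary (hcksa j t)
  have hqc : ∀ j, Continuous (q j) := fun j =>
    continuousOn_cayley.comp_continuous
      (((continuous_const.sub hzc).mul (hkc j)).mul (continuous_const.sub hzc)) (hcksa j)
  have hq1 : ∀ j t, t ≤ T j → q j t = 1 := fun j t ht => by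
    simp only [hq, hk0 j t ht, mul_zero, zero_mul, cayley_zero]
  have hqW : ∀ j t, q j t - W j t ∈ I := by
    intro j t
    rw [← cayley_invCayley (hW1 j t)]
    refine cayley_sub_cayley_mem I (hcksa j t) (hksa j t) ?_
    have e1 : c t * k j t * c t - k j t = -(z t * (k j t * c t)) - k j t * z t := by
      simp only [hc]; noncomm_ring
    rw [e1]
    exact I.sub_mem (I.neg_mem (I.mul_mem_right _ _ (hz t).1)) (I.mul_mem_left _ _ (hz t).1)
  set P : ℕ → ℝ≥0 → M := fun n t => leftProd (fun j => q j t) n with hP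
  have hPc : ∀ n, Continuous (P n) := by
    intro n
    induction n with
    | zero => exact continuous_const
    | succ n ih => exact (hqc n).mul ih
  have hPeq : ∀ {m n : ℕ} {t : ℝ≥0}, m ≤ n → t ≤ T m → P n t = P m t := fun hmn ht =>
    leftProd_eq_of_le hmn fun j hj => hq1 j _ (ht.trans (hTm hj))
  have hTN : ∀ t : ℝ≥0, t ≤ T (N ⌈t⌉₊) := fun t => (Nat.le_ceil t).trans (hN _)
  -- The number of factors jumps with `⌈t⌉₊`, but the additional ones equal `1` at time `t`. So near
  -- `t₀` the path agrees with a single finite product.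
  refine ⟨fun t => P (N ⌈t⌉₊) t, ?_, fun t => leftProd_mem_unitary (fun j => hqu j t) _, ?_, ?_, ?_⟩
  · rw [continuous_iff_continuousAt]
    intro t₀
    refine ((hPc (N (⌈t₀⌉₊ + 1))).continuousAt (x := t₀)).congr ?_
    filter_upwards [Iio_mem_nhds (lt_add_one t₀)] with t ht
    refine hPeq (hNm.monotone ?_) (hTN t)
    rw [Nat.ceil_le, Nat.cast_succ]
    exact (le_of_lt ht).trans (add_le_add_left (Nat.le_ceil t₀) 1)
  · change P (N ⌈(0 : ℝ≥0)⌉₊) 0 = 1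
    rw [hPeq (Nat.zero_le _) zero_le]
    rfl
  · intro t
    have h1 := leftProd_pathFactor hUu hU0 hT0 hTm (N ⌈t⌉₊) t
    rw [min_eq_left (hTN t)] at h1
    rw [← h1]
    exact leftProd_sub_mem I (fun j => hqW j t) _
  · intro n ε hε
    obtain ⟨m, hm⟩ := exists_nat_gt (12 / ε)
    filter_upwards [eventually_ge_atTop ((max n m : ℕ) : ℝ≥0)] with t ht θ hθ
    have hle : max n m ≤ ⌈t⌉₊ := by
      exact_mod_cast ht.trans (Nat.le_ceil t)
    generalize hr : ⌈t⌉₊ = r at hle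
    have htr : t ≤ r := hr ▸ Nat.le_ceil t
    have hzt := hz t
    rw [hr] at hzt
    obtain ⟨-, -, -, hz4, hz5⟩ := hzt
    have hθ' : θ ∈ Θ r := hΘ ((le_max_left _ _).trans hle) hθ
    -- The constant is `6` from the compression times `2` from the Cayley transform.
    have hb : ∀ j < N r, ‖twistedComm (γ.toFun θ.2) θ.1 (q j t)‖ ≤ 12 * η r := by
      intro j hj
      have h1 : ‖twistedComm (γ.toFun θ.2) θ.1 (c t)‖ ≤ η r := by
        simp only [hc, map_sub, twistedComm_one, zero_sub, norm_neg]
        exact hz4 θ hθ'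
      have h2 : ‖c t * twistedComm (γ.toFun θ.2) θ.1 (k j t)‖ ≤ η r := by
        refine hz5 _ ?_
        simp only [hL, Set.mem_iUnion]
        exact ⟨j, Finset.mem_range.2 hj, (t, θ), ⟨⟨zero_le, htr⟩, hθ'⟩, rfl⟩
      have h3 := norm_twistedComm_compress_le _ _ (hkn j t) (hcn t) h1 h2
      have h4 := norm_twistedComm_cayley_le (γ.toFun θ.2) θ.1 (hcksa j t)
      linarith
    refine (norm_twistedComm_leftProd_le _ _ (fun j => hqu j t) hb).trans ?_
    have hrm : (m : ℝ) ≤ r := by exact_mod_cast (le_max_right _ _).trans hle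
    rw [div_lt_iff₀ hε] at hm
    simp only [hη]
    rw [← mul_assoc, mul_one_div, div_le_iff₀ (by positivity)]
    have h5 : 12 ≤ ε * ((r : ℝ) + 1) := by nlinarith
    have h6 : (0 : ℝ) ≤ N r := Nat.cast_nonneg _
    nlinarith

end PathLifting

/-! ### The algebra as an ideal of its multiplier algebra. -/

section Multiplier

variable {B : Type*} [NonUnitalCStarAlgebra B]

/-- The first components agree because, by centrality, their difference is annihilated by left
multiplication by every element of `B`, in particular by its own adjoint. -/
theorem DoubleCentralizer.mul_coe (x : 𝓜(ℂ, B)) (b : B) :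
    x * (b : 𝓜(ℂ, B)) = ((x.fst b : B) : 𝓜(ℂ, B)) := by
  refine DoubleCentralizer.ext ℂ B _ _ (Prod.ext ?_ ?_)
  · refine ContinuousLinearMap.ext fun c => ?_
    change x.fst (b * c) = x.fst b * c
    rw [← sub_eq_zero, ← CStarRing.star_mul_self_eq_zero_iff]
    have h : ∀ y : B, y * (x.fst (b * c) - x.fst b * c) = 0 := fun y => by
      rw [mul_sub, ← x.central, ← mul_assoc, ← mul_assoc, ← x.central, sub_self]
    exact h _
  · refine ContinuousLinearMap.ext fun c => ?_
    change x.snd c * b = c * x.fst b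
    exact x.central c b

theorem DoubleCentralizer.star_coe (b : B) : star (b : 𝓜(ℂ, B)) = ((star b : B) : 𝓜(ℂ, B)) :=
  (map_star (DoubleCentralizer.coeHom (𝕜 := ℂ) (A := B)) b).symm

theorem DoubleCentralizer.coe_mul' (b : B) (x : 𝓜(ℂ, B)) :
    (b : 𝓜(ℂ, B)) * x = ((x.snd b : B) : 𝓜(ℂ, B)) := by
  have h := congrArg star (DoubleCentralizer.mul_coe (star x) (star b))
  simpa [DoubleCentralizer.star_coe] using h

theorem DoubleCentralizer.continuous_coe : Continuous fun b : B => (b : 𝓜(ℂ, B)) := by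
  refine continuous_iff_continuousAt.2 fun b => tendsto_iff_norm_sub_tendsto_zero.2 ?_
  refine squeeze_zero (fun _ => norm_nonneg _) (fun c => ?_)
    (tendsto_iff_norm_sub_tendsto_zero.1 (continuous_id.tendsto b))
  have h := map_sub (DoubleCentralizer.coeHom (𝕜 := ℂ) (A := B)) c b
  simp only [DoubleCentralizer.coeHom_apply] at h
  rw [← h]
  exact NonUnitalStarAlgHom.norm_apply_le (DoubleCentralizer.coeHom (𝕜 := ℂ) (A := B)) _

/-- The copy of `B` in its multiplier algebra as a two-sided ideal. -/
noncomputable def multiplierTwoSidedIdeal (B : Type*) [NonUnitalCStarAlgebra B] :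
    TwoSidedIdeal 𝓜(ℂ, B) :=
  TwoSidedIdeal.mk' (multiplierIdeal B)
    ⟨0, map_zero (DoubleCentralizer.coeHom (𝕜 := ℂ) (A := B))⟩
    (by
      rintro _ _ ⟨x, rfl⟩ ⟨y, rfl⟩
      exact ⟨x + y, map_add (DoubleCentralizer.coeHom (𝕜 := ℂ) (A := B)) x y⟩)
    (by
      rintro _ ⟨x, rfl⟩
      exact ⟨-x, map_neg (DoubleCentralizer.coeHom (𝕜 := ℂ) (A := B)) x⟩)
    (by
      rintro x _ ⟨y, rfl⟩
      exact ⟨x.fst y, (DoubleCentralizer.mul_coe x y).symm⟩)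
    (by
      rintro _ x ⟨y, rfl⟩
      exact ⟨x.snd y, (DoubleCentralizer.coe_mul' y x).symm⟩)

theorem mem_multiplierTwoSidedIdeal {x : 𝓜(ℂ, B)} :
    x ∈ multiplierTwoSidedIdeal B ↔ x ∈ multiplierIdeal B :=
  TwoSidedIdeal.mem_mk' _ _ _ _ _ _ _

theorem IsSigmaUnital.exists_isApproxUnitSeq (hB : IsSigmaUnital B) :
    ∃ e : ℕ → 𝓜(ℂ, B), IsApproxUnitSeq (multiplierTwoSidedIdeal B) e := by
  obtain ⟨e, h1, h2, h3⟩ := hB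
  refine ⟨fun n => (e n : 𝓜(ℂ, B)), fun n => mem_multiplierTwoSidedIdeal.2 ⟨e n, rfl⟩,
    fun n => ?_, fun n => ?_, fun b hb => ?_⟩
  · obtain ⟨c, hc⟩ := h1 n
    rw [IsSelfAdjoint, DoubleCentralizer.star_coe, hc, star_mul, star_star]
  · exact (NonUnitalStarAlgHom.norm_apply_le
      (DoubleCentralizer.coeHom (𝕜 := ℂ) (A := B)) (e n)).trans (h2 n)
  · obtain ⟨b, rfl⟩ := mem_multiplierTwoSidedIdeal.1 hb
    have h := (DoubleCentralizer.continuous_coe.tendsto b).comp (h3 b)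
    exact h.congr fun n => map_mul (DoubleCentralizer.coeHom (𝕜 := ℂ) (A := B)) (e n) b

theorem StrictlyContinuous.continuous_fst_apply {X : Type*} [TopologicalSpace X]
    {u : X → 𝓜(ℂ, B)} (hu : StrictlyContinuous u) (hn : ∀ x, ‖u x‖ ≤ 1) {y : X → B}
    (hy : Continuous y) : Continuous fun x => (u x).fst (y x) := by
  refine continuous_iff_continuousAt.2 fun x₀ => tendsto_iff_norm_sub_tendsto_zero.2 ?_
  have h1 := tendsto_iff_norm_sub_tendsto_zero.1 (hy.tendsto x₀)
  have h2 := tendsto_iff_norm_sub_tendsto_zero.1 ((hu (y x₀)).1.tendsto x₀)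
  have h3 := h1.add h2
  rw [add_zero] at h3
  refine squeeze_zero (fun _ => norm_nonneg _) (fun x => ?_) h3
  have h4 : ‖(u x).fst (y x - y x₀)‖ ≤ ‖y x - y x₀‖ := by
    refine ((u x).fst.le_opNorm _).trans (mul_le_of_le_one_left (norm_nonneg _) ?_)
    rw [DoubleCentralizer.norm_fst]
    exact hn x
  rw [map_sub] at h4
  exact (norm_sub_le_norm_sub_add_norm_sub _ ((u x).fst (y x₀)) _).trans (add_le_add_left h4 _)

end Multiplier

/-! ### The perturbed action and the reduction to an asymptotically central path. -/

section CocycleRep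

variable {G A B : Type*} [Group G] [TopologicalSpace G]
  [NonUnitalCStarAlgebra A] [NonUnitalCStarAlgebra B]

theorem CStarAction.ext_one (β : CStarAction G B) (x : 𝓜(ℂ, B)) : β.ext 1 x = x := by
  ext b <;> simp [CStarAction.ext, multiplierExtension] <;> rfl

theorem CStarAction.ext_mul (β : CStarAction G B) (g h : G) (x : 𝓜(ℂ, B)) :
    β.ext (g * h) x = β.ext g (β.ext h x) := by
  ext b <;> simp [CStarAction.ext, multiplierExtension] <;> rfl

namespace CocycleRep

variable {α : CStarAction G A} {β : CStarAction G B}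

theorem u_one (ρ : CocycleRep α β) : (ρ.u 1 : 𝓜(ℂ, B)) = 1 := by
  have h := ρ.cocycle 1 1
  rw [mul_one, β.ext_one] at h
  calc (ρ.u 1 : 𝓜(ℂ, B)) = star (ρ.u 1 : 𝓜(ℂ, B)) * (ρ.u 1 * ρ.u 1) := by
        rw [← mul_assoc, Unitary.coe_star_mul_self, one_mul]
    _ = 1 := by rw [← h, Unitary.coe_star_mul_self]

/-- The perturbed action by `⋆`-endomorphisms of the multiplier algebra. -/
noncomputable def perturbedHom (ρ : CocycleRep α β) (g : G) : 𝓜(ℂ, B) →⋆ₐ[ℂ] 𝓜(ℂ, B) where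
  toFun := ρ.perturbed g
  map_one' := by simp [perturbed]
  map_mul' x y := by
    simp only [perturbed, map_mul]
    calc _ = (ρ.u g : 𝓜(ℂ, B)) * β.ext g x * (star (ρ.u g : 𝓜(ℂ, B)) * ρ.u g) * β.ext g y *
          star (ρ.u g : 𝓜(ℂ, B)) := by
          rw [Unitary.coe_star_mul_self]; noncomm_ring
      _ = _ := by noncomm_ring
  map_zero' := by simp [perturbed]
  map_add' x y := by simp only [perturbed, map_add]; noncomm_ring
  commutes' c := by
    simp [perturbed, Algebra.algebraMap_eq_smul_one]
  map_star' x := by simp [perturbed, map_star, mul_assoc]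

theorem perturbedHom_apply (ρ : CocycleRep α β) (g : G) (x : 𝓜(ℂ, B)) :
    ρ.perturbedHom g x = ρ.u g * β.ext g x * star (ρ.u g : 𝓜(ℂ, B)) := rfl

theorem perturbedHom_coe (ρ : CocycleRep α β) (g : G) (b : B) :
    ρ.perturbedHom g (b : 𝓜(ℂ, B)) =
      ((star ((ρ.u g : 𝓜(ℂ, B)).fst (star ((ρ.u g : 𝓜(ℂ, B)).fst (β.toHom g b)))) : B) :
        𝓜(ℂ, B)) := by
  rw [perturbedHom_apply, CStarAction.ext, multiplierExtension_coe]
  generalize (ρ.u g : 𝓜(ℂ, B)) = x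
  rw [← DoubleCentralizer.star_coe, ← DoubleCentralizer.mul_coe x (star _),
    ← DoubleCentralizer.star_coe, ← DoubleCentralizer.mul_coe x, star_mul, star_star]

/-- The perturbed action as an action that is point-norm continuous on `B`. -/
noncomputable def perturbedAction (ρ : CocycleRep α β) :
    IdealAction G (multiplierTwoSidedIdeal B) where
  toFun := ρ.perturbedHom
  map_one x := by simp [perturbedHom_apply, u_one, β.ext_one]
  map_mul g h x := by
    simp only [perturbedHom_apply]
    simp only [ρ.cocycle, β.ext_mul, map_mul, map_star, star_mul, mul_assoc]
  map_mem g b hb := by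
    obtain ⟨b, rfl⟩ := mem_multiplierTwoSidedIdeal.1 hb
    exact mem_multiplierTwoSidedIdeal.2 ⟨_, (ρ.perturbedHom_coe g b).symm⟩
  continuous_apply b hb := by
    obtain ⟨b, rfl⟩ := mem_multiplierTwoSidedIdeal.1 hb
    simp only [perturbedHom_coe]
    have hn : ∀ g, ‖(ρ.u g : 𝓜(ℂ, B))‖ ≤ 1 := fun g => norm_unitary_le_one (ρ.u g).2
    exact DoubleCentralizer.continuous_coe.comp (ρ.strictlyContinuous.continuous_fst_apply hn
      (ρ.strictlyContinuous.continuous_fst_apply hn (β.continuous_apply b)).star).star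

/-- Conjugating by a path `U` has the same limit behaviour as conjugating by `U w⋆` if `w` is
asymptotically central and invariant. -/
theorem AsymptoticallyConjugates.mul_star {ρ σ : CocycleRep α β} {U w : ℝ≥0 → unitary 𝓜(ℂ, B)}
    (h : ρ.AsymptoticallyConjugates σ U)
    (hφ : ∀ a, Tendsto (fun t => ‖ρ.φ a * (w t : 𝓜(ℂ, B)) - w t * ρ.φ a‖) atTop (𝓝 0))
    (hu : ∀ K : Set G, IsCompact K → ∀ ε : ℝ, 0 < ε → ∀ᶠ t in atTop, ∀ g ∈ K,
      ‖ρ.perturbed g (w t) - w t‖ ≤ ε) :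
    ρ.AsymptoticallyConjugates σ fun t => U t * star (w t) := by
  refine ⟨fun a => ?_, fun K hK ε hε => ?_⟩
  · have h1 := (h.1 a).add (hφ a)
    rw [add_zero] at h1
    refine squeeze_zero (fun _ => norm_nonneg _) (fun t => ?_) h1
    have e : σ.φ a - ((U t * star (w t) : unitary 𝓜(ℂ, B)) : 𝓜(ℂ, B)) * ρ.φ a *
          star ((U t * star (w t) : unitary 𝓜(ℂ, B)) : 𝓜(ℂ, B)) =
        (σ.φ a - U t * ρ.φ a * star (U t : 𝓜(ℂ, B))) -
          U t * (star (w t : 𝓜(ℂ, B)) * (ρ.φ a * w t - w t * ρ.φ a) * star (U t : 𝓜(ℂ, B))) := by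
      -- Passing from `U` to `U * star w` changes the conjugate of `φ a` by the commutator of `φ a`
      -- with `w`, multiplied by unitaries; the cocycle is treated likewise below.
      have e1 : star (w t : 𝓜(ℂ, B)) * (ρ.φ a * w t - w t * ρ.φ a) =
          star (w t : 𝓜(ℂ, B)) * ρ.φ a * w t - ρ.φ a := by
        rw [mul_sub, ← mul_assoc, ← mul_assoc, Unitary.coe_star_mul_self, one_mul]
      rw [e1]
      simp only [Submonoid.coe_mul, Unitary.coe_star, star_mul, star_star]
      noncomm_ring
    rw [e]
    refine (norm_sub_le _ _).trans (add_le_add_right ?_ _)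
    refine (norm_mul_le_of_le (norm_unitary_le_one (U t).2) (norm_mul_le_of_le
      (norm_mul_le_of_le (norm_unitary_le_one (Unitary.star_mem (w t).2)) le_rfl)
        (norm_unitary_le_one (Unitary.star_mem (U t).2)))).trans ?_
    simp
  · filter_upwards [h.2 K hK (ε / 2) (half_pos hε), hu K hK (ε / 2) (half_pos hε)]
      with t h1 h2 g hg
    have e : (σ.u g : 𝓜(ℂ, B)) - ((U t * star (w t) : unitary 𝓜(ℂ, B)) : 𝓜(ℂ, B)) * ρ.u g *
          star (β.ext g ((U t * star (w t) : unitary 𝓜(ℂ, B)) : 𝓜(ℂ, B))) =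
        (σ.u g - U t * ρ.u g * star (β.ext g (U t))) -
          U t * (star (w t : 𝓜(ℂ, B)) * (ρ.perturbed g (w t) - w t) *
            (ρ.u g * star (β.ext g (U t)))) := by
      have e1 : star (w t : 𝓜(ℂ, B)) * (ρ.perturbed g (w t) - w t) * ρ.u g =
          star (w t : 𝓜(ℂ, B)) * ρ.u g * β.ext g (w t) - ρ.u g := by
        rw [mul_sub, Unitary.coe_star_mul_self, sub_mul, one_mul, perturbed, mul_assoc, mul_assoc,
          Unitary.coe_star_mul_self, mul_one, mul_assoc]
      rw [← mul_assoc _ (ρ.u g : 𝓜(ℂ, B)), e1]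
      simp only [Submonoid.coe_mul, Unitary.coe_star, map_mul, map_star, star_mul, star_star]
      noncomm_ring
    have h3 : ‖star (β.ext g (U t : 𝓜(ℂ, B)))‖ ≤ 1 := by
      rw [norm_star]
      exact (NonUnitalStarAlgHom.norm_apply_le (β.ext g) _).trans (norm_unitary_le_one (U t).2)
    have h4 := norm_mul_le_of_le (norm_unitary_le_one (U t).2) (norm_mul_le_of_le
      (norm_mul_le_of_le (norm_unitary_le_one (Unitary.star_mem (w t).2)) (h2 g hg))
        (norm_mul_le_of_le (norm_unitary_le_one (ρ.u g).2) h3))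
    rw [e]
    refine (norm_sub_le _ _).trans ?_
    linarith [h1 g hg]

end CocycleRep

/-- An asymptotically central path for a dense sequence is asymptotically central. -/
theorem tendsto_norm_commutator_of_denseRange {M : Type*} [CStarAlgebra M] (φ : A →⋆ₙₐ[ℂ] M)
    {d : ℕ → A} (hd : DenseRange d) {w : ℝ≥0 → M} (hw : ∀ t, w t ∈ unitary M)
    (h : ∀ i, ∀ ε : ℝ, 0 < ε → ∀ᶠ t in atTop, ‖φ (d i) * w t - w t * φ (d i)‖ ≤ ε) (a : A) :
    Tendsto (fun t => ‖φ a * w t - w t * φ a‖) atTop (𝓝 0) := by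
  rw [Metric.tendsto_nhds]
  intro ε hε
  obtain ⟨i, hi⟩ := hd.exists_dist_lt a (show 0 < ε / 4 by positivity)
  filter_upwards [h i (ε / 4) (by positivity)] with t ht
  have h1 : ‖φ (a - d i)‖ ≤ ε / 4 := by
    rw [dist_eq_norm] at hi
    exact (NonUnitalStarAlgHom.norm_apply_le φ _).trans hi.le
  have h2 := norm_unitary_le_one (hw t)
  have e : φ a * w t - w t * φ a =
      φ (a - d i) * w t - w t * φ (a - d i) + (φ (d i) * w t - w t * φ (d i)) := by
    rw [map_sub]; noncomm_ring
  have h3 := norm_mul_le_of_le h1 h2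
  have h4 := norm_mul_le_of_le h2 h1
  have h5 := norm_add_le (φ (a - d i) * w t - w t * φ (a - d i))
    (φ (d i) * w t - w t * φ (d i))
  have h6 := norm_sub_le (φ (a - d i) * w t) (w t * φ (a - d i))
  rw [dist_zero_right, norm_norm, e]
  linarith

end CocycleRep

theorem corollary4p4 {G : Type*} [Group G] [TopologicalSpace G] [IsTopologicalGroup G]
    [LocallyCompactSpace G] [SecondCountableTopology G]
    {A : Type*} [NonUnitalCStarAlgebra A] [TopologicalSpace.SeparableSpace A]
    {B : Type*} [NonUnitalCStarAlgebra B] (hB : IsSigmaUnital B)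
    (α : CStarAction G A) (β : CStarAction G B) (ρ σ : CocycleRep α β)
    (U : ℝ≥0 → unitary 𝓜(ℂ, B)) (hU : Continuous U)
    (hUD : ∀ t, (U t : 𝓜(ℂ, B)) ∈ ρ.D) (hU0 : U 0 = 1)
    (hconj : ρ.AsymptoticallyConjugates σ U) :
    ρ.StronglyAsymptoticallyUnitarilyEquivalent σ := by
  obtain ⟨e, he⟩ := hB.exists_isApproxUnitSeq
  set d : ℕ → A := TopologicalSpace.denseSeq A
  set K : CompactExhaustion G := CompactExhaustion.choice G
  -- Pairs `(φ (d i), 1)` encode commutation with a dense sequence, pairs `(1, g)` encode invariance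
  -- under `g` in an exhausting compact set.
  set Θ : ℕ → Set (𝓜(ℂ, B) × G) := fun n =>
    (fun i => (ρ.φ (d i), (1 : G))) '' Set.Iic n ∪ {1} ×ˢ K n with hΘ
  have hγ : ∀ t g, ρ.perturbedAction.toFun g (U t) - U t ∈ multiplierTwoSidedIdeal B := by
    intro t g
    have h := mem_multiplierTwoSidedIdeal.2 ((hUD t).1 g)
    rw [← neg_sub]
    exact TwoSidedIdeal.neg_mem _ h
  have hone : ∀ m y : 𝓜(ℂ, B),
      twistedComm (ρ.perturbedAction.toFun 1) m y = m * y - y * m := fun m y => by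
    rw [twistedComm_apply, IdealAction.map_one]
  have hinv : ∀ (g : G) (y : 𝓜(ℂ, B)),
      twistedComm (ρ.perturbedAction.toFun g) 1 y = ρ.perturbed g y - y := fun g y => by
    rw [twistedComm_apply, one_mul, mul_one]; rfl
  obtain ⟨w, hwc, hwu, hw0, hwI, hw⟩ := ρ.perturbedAction.exists_asymptotically_central_path he
    (Θ := Θ)
    (fun n => (((Set.finite_Iic n).image _).isCompact).union
      (isCompact_singleton.prod (K.isCompact n)))
    (fun m n hmn => Set.union_subset_union (Set.image_mono (Set.Iic_subset_Iic.2 hmn))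
      (Set.prod_mono subset_rfl (K.subset hmn)))
    (U := fun t => (U t : 𝓜(ℂ, B))) (continuous_subtype_val.comp hU) (fun t => (U t).2)
    (by rw [hU0]; rfl) hγ
    (by
      rintro t n _ (⟨i, -, rfl⟩ | ⟨h1, -⟩)
      · rw [hone, ← neg_sub]
        exact TwoSidedIdeal.neg_mem _ (mem_multiplierTwoSidedIdeal.2 ((hUD t).2 (d i)))
      · rw [Set.mem_singleton_iff.1 h1, hinv]
        exact hγ t _)
  refine ⟨fun t => U t * star (⟨w t, hwu t⟩ : unitary 𝓜(ℂ, B)), ?_, fun t => ?_, ?_, ?_⟩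
  · have : Continuous fun t => (⟨w t, hwu t⟩ : unitary 𝓜(ℂ, B)) := hwc.subtype_mk _
    exact hU.mul this.star
  · rw [← mem_multiplierTwoSidedIdeal]
    -- As `w t` is unitary, `U t * star (w t) - 1 = (U t - w t) * star (w t)`, a multiple of an
    -- element of `B`.
    have e1 : ((U t * star (⟨w t, hwu t⟩ : unitary 𝓜(ℂ, B)) : unitary 𝓜(ℂ, B)) : 𝓜(ℂ, B)) - 1 =
        -((w t - U t) * star (w t)) := by
      rw [sub_mul, Unitary.mul_star_self_of_mem (hwu t), neg_sub]; rfl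
    rw [e1]
    exact TwoSidedIdeal.neg_mem _ (TwoSidedIdeal.mul_mem_right _ _ _ (hwI t))
  · have : (⟨w 0, hwu 0⟩ : unitary 𝓜(ℂ, B)) = 1 := Subtype.ext hw0
    simp only [this, hU0, star_one, mul_one]
  · refine hconj.mul_star (w := fun t => ⟨w t, hwu t⟩) ?_ ?_
    · refine tendsto_norm_commutator_of_denseRange ρ.φ (TopologicalSpace.denseRange_denseSeq A) hwu
        fun i ε hε => ?_
      filter_upwards [hw i ε hε] with t ht
      have h := ht (ρ.φ (d i), 1) (Or.inl ⟨i, Set.mem_Iic.2 le_rfl, rfl⟩)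
      rwa [hone] at h
    · intro C hC ε hε
      obtain ⟨n, hn⟩ := K.exists_superset_of_isCompact hC
      filter_upwards [hw n ε hε] with t ht g hg
      have h := ht (1, g) (Or.inr ⟨rfl, hn hg⟩)
      rwa [hinv] at h
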